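/- For $A\in\mathbb{R}^{l\times d}$ and $b\in\mathbb{R}^l$ let $W=\{x\in\mathbb{R}^d \mid Ax<b\}$ (componentwise strict inequalities), and for $P\subset\mathbb{R}^d$ put $$\operatorname{Sep}_W(P)=\{P\cap(t+W)\mid t\in\mathbb{R}^d\}.$$ \textbf{Model.} A real RAM is a program over storage cells (directly addressed registers and indirectly addressed memory banks) each holding one real number, built from assignments of integer constants, copying, the operations $+,-,\cdot,/$, reading and writing of memory at a computed natural-number address, comparisons ($<,\le,=$), branching and loops; each arithmetic operation, assignment, memory access and comparison costs one unit, and there is no rounding operation. The input consists of $l$, $q$, the entries of $A$ and $b$, and the coordinates of an enumeration $p_1,\dots,p_q$ of a finite set $P$ with $q$ points; the output is a list (repetitions allowed) of $0$-$1$ incidence vectors of subsets of $P$. \textbf{Theorem.} For every fixed dimension $d\ge 1$ there is a real RAM program that, for all $l$, $A$, $b$ and all finite sets $P=\{p_1,\dots,p_q\}\subset\mathbb{R}^d$ with $q$ points, halts with a list whose members are exactly the members of $\operatorname{Sep}_W(P)$, after $O((lq)^{d+1})$ operations, where the constant in $O(\cdot)$ depends only on $d$ (a factor $l=0$ or $q=0$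 being replaced by $1$). Hence, for each fixed $W=\{x\mid Ax<b\}$, it computes $\operatorname{Sep}_W(P)$ with $O(\operatorname{card}(P)^{d+1})$ operations, the constant depending on $W$ (through $d,A,b$) only. Likewise, for each fixed $W=\{x\mid Ax\le b\}$ given as an intersection of finitely many halfspaces (all rows of $A$ nonzero), it computes $\operatorname{Sep}_{W^\circ}(P)$ for the interior $W^\circ$ of $W$ with $O(\operatorname{card}(P)^{d+1})$ operations. -/

import Mathlib

/-! ## The separation problem -/

/-- `S_{W,t}(P) = P ∩ (t + W)`. -/
def sepPart {d : ℕ} (W P : Set (Fin d → ℝ)) (t : Fin d → ℝ) : Set (Fin d → ℝ) :=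
  P ∩ (fun x => t + x) '' W

/-- `Sep_W(P) = {S_{W,t}(P) | t ∈ ℝ^d}`. -/
def SepFamily {d : ℕ} (W P : Set (Fin d → ℝ)) : Set (Set (Fin d → ℝ)) :=
  {S | ∃ t : Fin d → ℝ, S = sepPart W P t}

/-- The open polyhedron `{x | Ax < b}` (componentwise strict inequalities). -/
def openPolyhedron {l d : ℕ} (A : Matrix (Fin l) (Fin d) ℝ) (b : Fin l → ℝ) :
    Set (Fin d → ℝ) :=
  {x | ∀ i, (A.mulVec x) i < b i}

/-- The closed polyhedron `{x | Ax ≤ b}`. -/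
def closedPolyhedron {l d : ℕ} (A : Matrix (Fin l) (Fin d) ℝ) (b : Fin l → ℝ) :
    Set (Fin d → ℝ) :=
  {x | ∀ i, (A.mulVec x) i ≤ b i}

/-! ## The real RAM

A storage cell holds one real number. There are registers, addressed directly, and memory banks,
whose cells are addressed indirectly through the content of a register, which then has to be a
natural number. A program names only finitely many registers and banks. Each arithmetic operation,
each assignment, each memory access and each comparison costs one unit. There is no rounding
operation, and the only constants are integers. -/

namespace RealRAM

/-- The contents of the storage: registers, and memory banks (`bank a i` is cell `i` of bank `a`). -/
structure State where
  reg : ℕ → ℝ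
  bank : ℕ → ℕ → ℝ

/-- Overwrite register `x`. -/
def State.setReg (s : State) (x : ℕ) (v : ℝ) : State :=
  { s with reg := Function.update s.reg x v }

/-- Overwrite cell `i` of bank `a`. -/
def State.setBank (s : State) (a i : ℕ) (v : ℝ) : State :=
  { s with bank := Function.update s.bank a (Function.update (s.bank a) i v) }

/-- The four arithmetic operations. -/
inductive Op
  | add | sub | mul | div

/-- Comparisons of two registers. -/
inductive Test
  | lt (x y : ℕ)
  | le (x y : ℕ)
  | eq (x y : ℕ)

/-- Truth of a comparison in a given state. -/
def Test.Holds : Test → State → Prop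
  | .lt x y, s => s.reg x < s.reg y
  | .le x y, s => s.reg x ≤ s.reg y
  | .eq x y, s => s.reg x = s.reg y

/-- Programs. -/
inductive Program
  /-- no operation -/
  | skip
  /-- `reg x := c` -/
  | const (x : ℕ) (c : ℤ)
  /-- `reg x := reg y` -/
  | copy (x y : ℕ)
  /-- `reg x := reg y ∘ reg z` -/
  | arith (o : Op) (x y z : ℕ)
  /-- `reg x := bank a [reg y]` -/
  | load (x a y : ℕ)
  /-- `bank a [reg x] := reg y` -/
  | store (a x y : ℕ)
  /-- first `c₁`, then `c₂` -/
  | seq (c₁ c₂ : Program)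
  /-- `if b then c₁ else c₂` -/
  | ite (b : Test) (c₁ c₂ : Program)
  /-- `while b do c` -/
  | loop (b : Test) (c : Program)

/-- `Exec c s t n`: started in state `s`, the program `c` halts in state `t` after exactly `n`
elementary operations. A division by zero, and an access to a cell whose address is not a natural
number, are errors: there is then no `t`. -/
inductive Exec : Program → State → State → ℕ → Prop
  | skip (s : State) : Exec .skip s s 0
  | const (s : State) (x : ℕ) (c : ℤ) : Exec (.const x c) s (s.setReg x (c : ℝ)) 1
  | copy (s : State) (x y : ℕ) : Exec (.copy x y) s (s.setReg x (s.reg y)) 1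
  | add (s : State) (x y z : ℕ) :
      Exec (.arith .add x y z) s (s.setReg x (s.reg y + s.reg z)) 1
  | sub (s : State) (x y z : ℕ) :
      Exec (.arith .sub x y z) s (s.setReg x (s.reg y - s.reg z)) 1
  | mul (s : State) (x y z : ℕ) :
      Exec (.arith .mul x y z) s (s.setReg x (s.reg y * s.reg z)) 1
  | div (s : State) (x y z : ℕ) (h : s.reg z ≠ 0) :
      Exec (.arith .div x y z) s (s.setReg x (s.reg y / s.reg z)) 1
  | load (s : State) (x a y i : ℕ) (h : s.reg y = (i : ℝ)) :
      Exec (.load x a y) s (s.setReg x (s.bank a i)) 1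
  | store (s : State) (a x y i : ℕ) (h : s.reg x = (i : ℝ)) :
      Exec (.store a x y) s (s.setBank a i (s.reg y)) 1
  | seq (c₁ c₂ : Program) (s t u : State) (m n : ℕ) (h₁ : Exec c₁ s t m) (h₂ : Exec c₂ t u n) :
      Exec (.seq c₁ c₂) s u (m + n)
  | iteTrue (b : Test) (c₁ c₂ : Program) (s t : State) (n : ℕ) (hb : b.Holds s)
      (h : Exec c₁ s t n) : Exec (.ite b c₁ c₂) s t (n + 1)
  | iteFalse (b : Test) (c₁ c₂ : Program) (s t : State) (n : ℕ) (hb : ¬ b.Holds s)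
      (h : Exec c₂ s t n) : Exec (.ite b c₁ c₂) s t (n + 1)
  | loopDone (b : Test) (c : Program) (s : State) (hb : ¬ b.Holds s) : Exec (.loop b c) s s 1
  | loopStep (b : Test) (c : Program) (s t u : State) (m n : ℕ) (hb : b.Holds s)
      (h₁ : Exec c s t m) (h₂ : Exec (.loop b c) t u n) : Exec (.loop b c) s u (m + n + 1)

/-- A vector as a bank: entry `i` in cell `i`, all other cells `0`. -/
def vecBank {m : ℕ} (v : Fin m → ℝ) : ℕ → ℝ :=
  fun i => if h : i < m then v ⟨i, h⟩ else 0

/-- A matrix as a bank, row by row: entry `(i, k)` of an `m × n` matrix in cell `i * n + k`,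
all other cells `0`. -/
def matBank {m n : ℕ} (M : Fin m → Fin n → ℝ) : ℕ → ℝ :=
  fun a => if h : a < m * n then M (Fin.divNat ⟨a, h⟩) (Fin.modNat ⟨a, h⟩) else 0

/-- The initial state for the window given by `A`, `b` and the points `p 0, …, p (q - 1)`:
registers `0` and `1` hold `l` and `q`, banks `0`, `1` and `2` hold `A`, `b` and the coordinates of
the points; everything else is `0`. -/
def sepInput {l d q : ℕ} (A : Matrix (Fin l) (Fin d) ℝ) (b : Fin l → ℝ)
    (p : Fin q → Fin d → ℝ) : State where
  reg x := match x with
    | 0 => (l : ℝ)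
    | 1 => (q : ℝ)
    | _ => 0
  bank a := match a with
    | 0 => matBank A
    | 1 => vecBank b
    | 2 => matBank p
    | _ => fun _ => 0

/-- The state `s` displays the family `F` of subsets of `{p 0, …, p (q - 1)}`: register `0` holds
the length `m` of a list of subsets, the `r`-th of which is stored as its `0`-`1` incidence vector
in the cells `r * q, …, r * q + q - 1` of bank `3`; the members of the list are exactly the
members of `F`. -/
def Displays {d q : ℕ} (s : State) (p : Fin q → Fin d → ℝ) (F : Set (Set (Fin d → ℝ))) : Prop :=
  ∃ m : ℕ, s.reg 0 = (m : ℝ) ∧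
    (∀ r < m, ∀ j : Fin q, s.bank 3 (r * q + j) = 0 ∨ s.bank 3 (r * q + j) = 1) ∧
    F = {S | ∃ r < m, S = {x | ∃ j : Fin q, p j = x ∧ s.bank 3 (r * q + j) = 1}}

/-- On input `A`, `b` and the points `p j`, the program `c` halts after at most `N` elementary
operations and displays the family `F`. -/
def ComputesWithin (c : Program) {l d q : ℕ} (A : Matrix (Fin l) (Fin d) ℝ) (b : Fin l → ℝ)
    (p : Fin q → Fin d → ℝ) (F : Set (Set (Fin d → ℝ))) (N : ℕ) : Prop :=
  ∃ (s : State) (n : ℕ), Exec c (sepInput A b p) s n ∧ n ≤ N ∧ Displays s p F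

end RealRAM

/-! The translate `t + W` contains `p_j` exactly when `A_i t > A_i p_j - b_i` for all `i`. So the
separated set depends only on the cell of `t`, of whatever dimension, in the arrangement of the `lq`
hyperplanes `A_i t = A_i p_j - b_i`, and it is enough to visit every cell. The `d` coordinate
hyperplanes are added to make the normals span.

Cells are reached from bases of hyperplanes. The closure of a cell contains a vertex
(`exists_vertex_of_cell`). Blowing up at the vertex and inducting on the dimension gives hyperplanes
`h_j` with independent normals and signs `s_j ∈ {-1, 0, 1}` such that the solution `T(ε)` of
`a_{h_j} T = c_{h_j} + s_j ε^(j+1)` lies in the cell for all small `ε > 0` (`exists_flag_of_cell`).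
Conversely, any such system with nonsingular matrix has a solution, hence selects a set that some
translate really cuts out. This is `sepFamily_openPolyhedron_eq`.

No value of `ε` is ever chosen. By Cramer's rule `(det M)² (a ⬝ T(ε) - γ)` is a polynomial in `ε`,
positive for small `ε > 0` iff its coefficient vector is lexicographically positive
(`eventually_lexPos_cellCoeff_iff`). For fixed `d` this test takes boundedly many operations.

There are `3(lq + d)` signed hyperplanes, hence `O((lq)^d)` tuples, each followed by `lq` tests. The
machine part proves this count: `Runs` is a Hoare triple with a cost bound, `Realizable` compiles
fixed expressions to programs of bounded cost, and `exists_runs_nest` analyses the `d` nested loops.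
-/

open Filter Topology

/-! ### Cells of hyperplane arrangements. -/

section Cells

variable {V ι : Type} [NormedAddCommGroup V] [NormedSpace ℝ V]

lemma sign_add_of_abs_le {x y : ℝ} (h : |y| ≤ |x|) :
    x + y = 0 ∨ SignType.sign (x + y) = SignType.sign x := by
  rcases lt_trichotomy x 0 with hx | hx | hx
  · rw [abs_of_neg hx, abs_le] at h
    rcases (show x + y ≤ 0 by linarith).eq_or_lt with h0 | h0
    · exact Or.inl h0
    · exact Or.inr (by rw [sign_neg h0, sign_neg hx])
  · subst hx
    left
    simpa using h
  · rw [abs_of_pos hx, abs_le] at h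
    rcases (show 0 ≤ x + y by linarith).eq_or_lt with h0 | h0
    · exact Or.inl h0.symm
    · exact Or.inr (by rw [sign_pos h0, sign_pos hx])

/-- The closure of the cell of `t₀` in a hyperplane arrangement without common direction has a
vertex. -/
lemma exists_vertex_of_cell [Finite ι] (a : ι → V →ₗ[ℝ] ℝ) (c : ι → ℝ)
    (hsep : ∀ x, (∀ i, a i x = 0) → x = 0) (t₀ : V) :
    ∃ v, (∀ i, a i v - c i = 0 ∨ SignType.sign (a i v - c i) = SignType.sign (a i t₀ - c i)) ∧
      ∀ x, (∀ i, a i v - c i = 0 → a i x = 0) → x = 0 := by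
  let Compat : V → Prop := fun v =>
    ∀ i, a i v - c i = 0 ∨ SignType.sign (a i v - c i) = SignType.sign (a i t₀ - c i)
  let Z : V → Set ι := fun v => {i | a i v - c i = 0}
  -- Among the points of the closed cell, take one that lies on a maximal set of hyperplanes. If it
  -- were not a vertex, it could slide along a line inside all of them until it met another.
  obtain ⟨Z₀, hZ₀⟩ := (Set.toFinite (Z '' {v | Compat v})).exists_maximal
    ⟨Z t₀, t₀, fun i => Or.inr rfl, rfl⟩
  obtain ⟨⟨v, hv, rfl⟩, hmax⟩ := hZ₀
  refine ⟨v, hv, fun x hx => ?_⟩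
  by_contra hx0
  have hne : {i | a i x ≠ 0}.Nonempty := by
    by_contra h
    rw [Set.not_nonempty_iff_eq_empty] at h
    refine hx0 (hsep x fun i => ?_)
    by_contra hi
    exact (h ▸ (show i ∈ {i | a i x ≠ 0} from hi) : i ∈ (∅ : Set ι))
  -- The hyperplane nearest to `v` along the line `v + ℝ x`, in either direction: no other one is
  -- crossed before it, so signs can only become zero.
  obtain ⟨k, hk, hmin⟩ := Set.exists_min_image {i | a i x ≠ 0} (fun i => |(a i v - c i) / a i x|)
    (Set.toFinite _) hne
  simp only [Set.mem_ofPred_eq] at hk hmin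
  set τ : ℝ := -((a k v - c k) / a k x) with hτ
  have hval : ∀ i, a i (v + τ • x) - c i = (a i v - c i) + τ * a i x := by
    intro i
    simp only [map_add, map_smul, smul_eq_mul]
    ring
  have hcompat : Compat (v + τ • x) := by
    intro i
    rw [hval]
    by_cases hi : a i x = 0
    · simpa [hi] using hv i
    · have hle : |τ * a i x| ≤ |a i v - c i| := by
        have := hmin i hi
        rw [abs_div, abs_div, ← abs_div, le_div_iff₀ (abs_pos.2 hi)] at this
        rwa [abs_mul, hτ, abs_neg]
      rcases sign_add_of_abs_le hle with h | h
      · exact Or.inl h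
      · rw [h]
        rcases hv i with h' | h'
        · exact absurd (hx i h') hi
        · exact Or.inr h'
  have hsub : Z v ≤ Z (v + τ • x) := by
    intro i hi
    have hi' : a i v - c i = 0 := hi
    show _ = _
    rw [hval, hi', hx i hi']
    simp
  have hkmem : k ∈ Z (v + τ • x) := by
    show _ = _
    rw [hval, hτ]
    field_simp
    ring
  exact hk (hx k (hmax ⟨_, hcompat, rfl⟩ hsub hkmem))

lemma eventually_sign_eq {f : ℝ → ℝ} (hf : Continuous f) (h0 : f 0 ≠ 0) :
    ∀ᶠ ε in 𝓝[>] (0 : ℝ), SignType.sign (f ε) = SignType.sign (f 0) := by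
  apply Filter.Eventually.filter_mono nhdsWithin_le_nhds
  rcases lt_or_gt_of_ne h0 with h | h
  · filter_upwards [hf.continuousAt.eventually_lt_const h] with ε hε
    rw [sign_neg hε, sign_neg h]
  · filter_upwards [hf.continuousAt.eventually_const_lt h] with ε hε
    rw [sign_pos hε, sign_pos h]

/-- Every cell of a hyperplane arrangement without common direction contains the small points of a
curve obtained from a basis of hyperplanes by moving the `j`-th of them by `0` or `± ε ^ (j + 1)`. -/
theorem exists_flag_of_cell (n : ℕ) : ∀ {V : Type} [NormedAddCommGroup V] [NormedSpace ℝ V]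
    [FiniteDimensional ℝ V] (_ : Module.finrank ℝ V = n) {ι : Type} [Finite ι]
    (a : ι → V →ₗ[ℝ] ℝ) (c : ι → ℝ) (_ : ∀ x, (∀ i, a i x = 0) → x = 0) (t₀ : V),
    ∃ (h : Fin n → ι) (s : Fin n → SignType) (T : ℝ → V), Continuous T ∧
      (∀ x, (∀ j, a (h j) x = 0) → x = 0) ∧
      (∀ ε j, a (h j) (T ε) - c (h j) = (s j : ℝ) * ε ^ ((j : ℕ) + 1)) ∧
      ∀ᶠ ε in 𝓝[>] (0 : ℝ), ∀ i,
        SignType.sign (a i (T ε) - c i) = SignType.sign (a i t₀ - c i) := by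
  induction n with
  | zero =>
    intro V _ _ _ hn ι _ a c hsep t₀
    have := Module.finrank_zero_iff.1 hn
    exact ⟨Fin.elim0, Fin.elim0, fun _ => t₀, continuous_const, fun x _ => Subsingleton.elim _ _,
      fun _ j => j.elim0, Eventually.of_forall fun _ _ => rfl⟩
  | succ n ih =>
    intro V _ _ _ hn ι _ a c hsep t₀
    obtain ⟨v, hv, hvsep⟩ := exists_vertex_of_cell a c hsep t₀
    have : Nontrivial V := Module.nontrivial_of_finrank_pos (R := ℝ) (by omega)
    obtain ⟨x, hx⟩ := exists_ne (0 : V)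
    obtain ⟨k, hk, hkx⟩ : ∃ k, a k v - c k = 0 ∧ a k x ≠ 0 := by
      by_contra! H
      exact hx (hvsep x H)
    have hak : a k ≠ 0 := fun h => hkx (by rw [h]; rfl)
    obtain ⟨e, he⟩ : ∃ e, a k e = 1 := ⟨(a k x)⁻¹ • x, by simp [hkx]⟩
    -- Rescaling `t₀ - v` by `κ > 0` brings it to the level `a k = s₁` with `s₁ ∈ {-1, 0, 1}`.
    obtain ⟨κ, hκ, hκs⟩ : ∃ κ : ℝ, 0 < κ ∧
        κ * a k (t₀ - v) = (SignType.sign (a k (t₀ - v)) : ℝ) := by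
      by_cases h0 : a k (t₀ - v) = 0
      · exact ⟨1, one_pos, by simp [h0]⟩
      · refine ⟨|a k (t₀ - v)|⁻¹, by positivity, ?_⟩
        rw [inv_mul_eq_div, div_eq_iff (abs_ne_zero.2 h0), sign_mul_abs]
    set s₁ := SignType.sign (a k (t₀ - v)) with hs₁
    have hmem : κ • (t₀ - v) - (s₁ : ℝ) • e ∈ LinearMap.ker (a k) := by
      rw [LinearMap.mem_ker, map_sub, map_smul, map_smul, he, smul_eq_mul, hκs]
      simp
    have hrank : Module.finrank ℝ (LinearMap.ker (a k)) = n := by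
      have := Module.Dual.finrank_ker_add_one_of_ne_zero (f := a k) hak
      omega
    -- Only the hyperplanes through `v` matter near `v`. They are cut with the slice `a k = s₁`,
    -- which is identified with `ker (a k)` by subtracting `s₁ • e`; this shift produces the
    -- right-hand sides `-s₁ a_i e`.
    obtain ⟨h, s, T, hT, hindep, hcurve, hev⟩ := ih hrank (ι := {i // a i v - c i = 0})
      (fun i => (a i) ∘ₗ (LinearMap.ker (a k)).subtype) (fun i => -((s₁ : ℝ) * a i e))
      (fun x hx => Subtype.ext (hvsep x fun i hi => hx ⟨i, hi⟩)) ⟨_, hmem⟩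
    -- The factor `ε` gives hyperplane `k` the offset `s₁ ε` and raises the exponents of the
    -- inductive curve by one.
    have hcont : Continuous fun ε => v + ε • ((T ε : V) + (s₁ : ℝ) • e) := by fun_prop
    have hval : ∀ i ε, a i (v + ε • ((T ε : V) + (s₁ : ℝ) • e)) - c i =
        (a i v - c i) + ε * (a i (T ε) + s₁ * a i e) := by
      intro i ε
      simp only [map_add, map_smul, smul_eq_mul]
      ring
    refine ⟨Fin.cons k fun j => (h j : ι), Fin.cons s₁ s,
      fun ε => v + ε • ((T ε : V) + (s₁ : ℝ) • e), hcont, ?_, ?_, ?_⟩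
    · intro x hx
      have h1 : a k x = 0 := hx 0
      have := hindep ⟨x, h1⟩ fun j => by simpa using hx j.succ
      exact congrArg Subtype.val this
    · intro ε j
      refine Fin.cases ?_ (fun j => ?_) j
      · have : a k (T ε) = 0 := (T ε).2
        simp only [Fin.cons_zero]
        rw [hval, hk, this, he]
        simp [mul_comm]
      · simp only [Fin.cons_succ]
        have := hcurve ε j
        simp only [LinearMap.comp_apply, Submodule.subtype_apply, sub_neg_eq_add] at this
        rw [hval, (h j).2, this]
        simp only [Fin.val_succ]
        ring
    · have hpos : ∀ᶠ ε in 𝓝[>] (0 : ℝ), 0 < ε := eventually_mem_nhdsWithin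
      -- For hyperplanes through `v` the sign is that of a linear form on directions from `v`,
      -- unaffected by the positive factors `ε` and `κ`. The others keep their sign by continuity,
      -- since the curve starts at `v`.
      have hZ : ∀ i, a i v - c i = 0 → ∀ᶠ ε in 𝓝[>] (0 : ℝ),
          SignType.sign (a i (v + ε • ((T ε : V) + (s₁ : ℝ) • e)) - c i) =
            SignType.sign (a i t₀ - c i) := by
        intro i hi
        filter_upwards [hev, hpos] with ε hε hε0
        have := hε ⟨i, hi⟩
        simp only [LinearMap.comp_apply, Submodule.subtype_apply, sub_neg_eq_add, map_sub, map_smul,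
          smul_eq_mul, sub_add_cancel] at this
        rw [hval, hi, zero_add, sign_mul, sign_pos hε0, one_mul, this, sign_mul, sign_pos hκ,
          one_mul]
        congr 1
        linarith
      rw [eventually_all]
      intro i
      rcases hv i with hi | hi
      · exact hZ i hi
      · by_cases hi0 : a i v - c i = 0
        · exact hZ i hi0
        · have hai : Continuous (a i) := (a i).continuous_of_finiteDimensional
          have := eventually_sign_eq (f := fun ε => a i (v + ε • ((T ε : V) + (s₁ : ℝ) • e)) - c i)
            ((hai.comp hcont).sub continuous_const) (by simpa using hi0)
          filter_upwards [this] with ε hε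
          rw [hε, ← hi]
          simp

end Cells

/-! ### Signs of polynomials at small positive arguments. -/

/-- Lexicographic positivity. -/
def LexPos : List ℝ → Prop
  | [] => False
  | x :: L => 0 < x ∨ (x = 0 ∧ LexPos L)

/-- The value at `ε` of the polynomial with the given coefficients. -/
def hornerEval (ε : ℝ) : List ℝ → ℝ
  | [] => 0
  | x :: L => x + ε * hornerEval ε L

lemma continuous_hornerEval (L : List ℝ) : Continuous fun ε => hornerEval ε L := by
  induction L with
  | nil => exact continuous_const
  | cons x L ih => exact continuous_const.add (continuous_id.mul ih)

/-- The first nonzero coefficient dominates: a nonzero constant term fixes the sign near `0`, and a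
vanishing one leaves a positive factor `ε` to divide out. -/
lemma eventually_hornerEval_pos_iff (L : List ℝ) :
    ∀ᶠ ε in 𝓝[>] (0 : ℝ), (0 < hornerEval ε L ↔ LexPos L) := by
  induction L with
  | nil => simp [hornerEval, LexPos]
  | cons x L ih =>
    by_cases hx : x = 0
    · filter_upwards [ih, eventually_mem_nhdsWithin] with ε hε hε0
      simp [hornerEval, LexPos, hx, ← hε, mul_pos_iff_of_pos_left (show 0 < ε from hε0)]
    · have := eventually_sign_eq (continuous_hornerEval (x :: L)) (by simpa [hornerEval] using hx)
      filter_upwards [this] with ε hε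
      have h2 : hornerEval 0 (x :: L) = x := by simp [hornerEval]
      rw [h2] at hε
      rw [← sign_eq_one_iff, hε, sign_eq_one_iff]
      simp [LexPos, hx]

lemma hornerEval_ofFn (ε : ℝ) {n : ℕ} (E : Fin n → ℝ) :
    hornerEval ε (List.ofFn E) = ∑ k, E k * ε ^ (k : ℕ) := by
  induction n with
  | zero => simp [hornerEval]
  | succ n ih =>
    rw [List.ofFn_succ, hornerEval, ih, Fin.sum_univ_succ, Finset.mul_sum]
    simp only [Fin.val_zero, pow_zero, mul_one, Fin.val_succ]
    congr 1
    exact Finset.sum_congr rfl fun k _ => by ring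

/-! ### Cramer's rule without division. -/

section Coefficients

variable {d : ℕ}

/-- For the solution `T` of `M T = c + (s_j ε ^ (j + 1))_j`, the coefficients of the polynomial
`(det M)² (a ⬝ T - γ)` in `ε`. -/
noncomputable def cellCoeff (M : Matrix (Fin d) (Fin d) ℝ) (c s a : Fin d → ℝ) (γ : ℝ) :
    Fin (d + 1) → ℝ :=
  Fin.cons (M.det * (∑ j, Matrix.vecMul a M.adjugate j * c j - γ * M.det))
    fun j => M.det * (Matrix.vecMul a M.adjugate j * s j)

/-- Since `adjugate M * M = det M • 1`, the number `det M * (a ⬝ T)` is a linear form in `M T`,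
which is known. Multiplying once more by `det M` turns the factor into a square, so that it does not
affect the sign. -/
lemma hornerEval_cellCoeff (M : Matrix (Fin d) (Fin d) ℝ) (c s a : Fin d → ℝ) (γ ε : ℝ)
    (T : Fin d → ℝ) (hT : ∀ j, M.mulVec T j - c j = s j * ε ^ ((j : ℕ) + 1)) :
    hornerEval ε (List.ofFn (cellCoeff M c s a γ)) = M.det ^ 2 * (a ⬝ᵥ T - γ) := by
  have h1 : M.det * (a ⬝ᵥ T) = ∑ j, Matrix.vecMul a M.adjugate j * M.mulVec T j := by
    have : Matrix.vecMul a M.adjugate ⬝ᵥ M.mulVec T = M.det * (a ⬝ᵥ T) := by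
      rw [← Matrix.dotProduct_mulVec, Matrix.mulVec_mulVec, Matrix.adjugate_mul, Matrix.smul_mulVec,
        Matrix.one_mulVec, dotProduct_smul, smul_eq_mul]
    rw [← this]
    rfl
  have h2 : ∀ j, M.mulVec T j = c j + s j * ε ^ ((j : ℕ) + 1) := fun j => by
    rw [← hT]; ring
  simp only [h2, mul_add, Finset.sum_add_distrib] at h1
  rw [hornerEval_ofFn, Fin.sum_univ_succ]
  simp only [cellCoeff, Fin.cons_zero, Fin.cons_succ, Fin.val_zero, pow_zero, mul_one, Fin.val_succ]
  have h3 : M.det ^ 2 * (a ⬝ᵥ T - γ) = M.det * (M.det * (a ⬝ᵥ T) - γ * M.det) := by ring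
  rw [h3, h1]
  have h4 : ∑ x, M.det * (Matrix.vecMul a M.adjugate x * s x) * ε ^ ((x : ℕ) + 1) =
      M.det * ∑ x, Matrix.vecMul a M.adjugate x * (s x * ε ^ ((x : ℕ) + 1)) := by
    rw [Finset.mul_sum]
    exact Finset.sum_congr rfl fun k _ => by ring
  rw [h4]
  ring

lemma eventually_lexPos_cellCoeff_iff {M : Matrix (Fin d) (Fin d) ℝ} (hM : M.det ≠ 0)
    (c s a : Fin d → ℝ) (γ : ℝ) (T : ℝ → Fin d → ℝ)
    (hT : ∀ ε j, M.mulVec (T ε) j - c j = s j * ε ^ ((j : ℕ) + 1)) :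
    ∀ᶠ ε in 𝓝[>] (0 : ℝ), (LexPos (List.ofFn (cellCoeff M c s a γ)) ↔ γ < a ⬝ᵥ T ε) := by
  filter_upwards [eventually_hornerEval_pos_iff (List.ofFn (cellCoeff M c s a γ))] with ε hε
  rw [← hε, hornerEval_cellCoeff M c s a γ ε (T ε) (hT ε), mul_pos_iff_of_pos_left (by positivity),
    sub_pos]

end Coefficients

/-! ### Separated sets as sets selected by signed bases. -/

section Table

/-- The hyperplanes of the arrangement, for a window with rows `α`, `β` and points `π`: entries
`0, …, d - 1` of row `h` are the normal and entry `d` is the right-hand side. First come the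
hyperplanes `A_i t = A_i p_j - b_i`, then the coordinate hyperplanes. -/
noncomputable def hyperplaneRow (l q d : ℕ) (α β π : ℕ → ℝ) (h e : ℕ) : ℝ :=
  if h < q * l then
    if e < d then α (h % l * d + e)
    else ∑ e' ∈ Finset.range d, α (h % l * d + e') * π (h / l * d + e') - β (h % l)
  else if e = h - q * l then 1 else 0

/-- Every hyperplane three times, with the additional entries `-1`, `0`, `1`. -/
noncomputable def signedRow (l q d : ℕ) (α β π : ℕ → ℝ) (r e : ℕ) : ℝ :=
  if e = d + 1 then (r % 3 : ℕ) - 1 else hyperplaneRow l q d α β π (r / 3) e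

/-- The matrix formed by the normals of the rows `X 0, …, X (d - 1)`. -/
def normalMatrix (d : ℕ) (X : ℕ → ℕ → ℝ) : Matrix (Fin d) (Fin d) ℝ := fun k e => X k e

/-- The coefficients deciding the position of row `X d` to the point given by `X 0, …, X (d - 1)`. -/
noncomputable def rowCoeff (d : ℕ) (X : ℕ → ℕ → ℝ) : Fin (d + 1) → ℝ :=
  cellCoeff (normalMatrix d X) (fun k => X k d) (fun k => X k (d + 1)) (fun e => X d e) (X d d)

/-- Point `j` belongs to the set selected by the rows `w 0, …, w (d - 1)` of the table `f`. -/
def SelectsPoint (l d : ℕ) (f : ℕ → ℕ → ℝ) (w : ℕ → ℕ) (j : ℕ) : Prop :=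
  ∀ i < l, LexPos (List.ofFn (rowCoeff d fun k => f (if k < d then w k else 3 * (j * l + i))))

lemma matBank_apply {m n : ℕ} (M : Fin m → Fin n → ℝ) (i : Fin m) (e : Fin n) :
    RealRAM.matBank M (i * n + e) = M i e := by
  have h : (i : ℕ) * n + e < m * n := by
    calc (i : ℕ) * n + e < i * n + n := by omega
      _ = (i + 1) * n := by ring
      _ ≤ m * n := Nat.mul_le_mul_right _ i.2
  have hn : 0 < n := e.pos
  rw [RealRAM.matBank, dif_pos h]
  congr 1
  · ext
    show ((i : ℕ) * n + e) / n = i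
    rw [add_comm, Nat.add_mul_div_right _ _ hn, Nat.div_eq_of_lt e.2, zero_add]
  · ext
    show ((i : ℕ) * n + e) % n = e
    rw [add_comm, Nat.add_mul_mod_self_right, Nat.mod_eq_of_lt e.2]

lemma vecBank_apply {m : ℕ} (v : Fin m → ℝ) (i : Fin m) : RealRAM.vecBank v i = v i := by
  rw [RealRAM.vecBank, dif_pos i.2]

/-- Solving `A (x - t) < b` for `t` turns membership of a point into strict sides of hyperplanes in
the space of translations. -/
lemma mem_sepPart_openPolyhedron {l d : ℕ} (A : Matrix (Fin l) (Fin d) ℝ) (b : Fin l → ℝ)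
    (P : Set (Fin d → ℝ)) (t x : Fin d → ℝ) :
    x ∈ sepPart (openPolyhedron A b) P t ↔ x ∈ P ∧ ∀ i, A i ⬝ᵥ x - b i < A i ⬝ᵥ t := by
  have : x ∈ (fun y => t + y) '' openPolyhedron A b ↔ ∀ i, A i ⬝ᵥ x - b i < A i ⬝ᵥ t := by
    constructor
    · rintro ⟨y, hy, rfl⟩ i
      have : A i ⬝ᵥ y < b i := hy i
      simp only [dotProduct_add]
      linarith
    · intro h
      refine ⟨x - t, fun i => ?_, by simp⟩
      have : A i ⬝ᵥ (x - t) < b i := by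
        rw [dotProduct_sub]
        linarith [h i]
      exact this
  rw [sepPart, Set.mem_inter_iff, this]

variable {l q d : ℕ} (A : Matrix (Fin l) (Fin d) ℝ) (b : Fin l → ℝ) (p : Fin q → Fin d → ℝ)

lemma mul_add_lt_mul {j i : ℕ} (hj : j < q) (hi : i < l) : j * l + i < q * l := by
  calc j * l + i < j * l + l := by omega
    _ = (j + 1) * l := by ring
    _ ≤ q * l := Nat.mul_le_mul_right _ hj

lemma mul_add_div_of_lt {j i : ℕ} (hi : i < l) : (j * l + i) / l = j := by
  rw [add_comm, Nat.add_mul_div_right _ _ (by omega), Nat.div_eq_of_lt hi, zero_add]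

lemma mul_add_mod_of_lt {j i : ℕ} (hi : i < l) : (j * l + i) % l = i := by
  rw [add_comm, Nat.add_mul_mod_self_right, Nat.mod_eq_of_lt hi]

open RealRAM in
lemma hyperplaneRow_normal (j : Fin q) (i : Fin l) (e : Fin d) :
    hyperplaneRow l q d (matBank A) (vecBank b) (matBank p) (j * l + i) e = A i e := by
  rw [hyperplaneRow, if_pos (mul_add_lt_mul j.2 i.2), if_pos e.2, mul_add_mod_of_lt i.2]
  exact matBank_apply A i e

open RealRAM in
lemma hyperplaneRow_rhs (j : Fin q) (i : Fin l) :
    hyperplaneRow l q d (matBank A) (vecBank b) (matBank p) (j * l + i) d =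
      A i ⬝ᵥ p j - b i := by
  rw [hyperplaneRow, if_pos (mul_add_lt_mul j.2 i.2), if_neg (lt_irrefl _), mul_add_mod_of_lt i.2,
    mul_add_div_of_lt i.2, vecBank_apply, Finset.sum_range]
  congr 1
  exact Finset.sum_congr rfl fun e _ => congrArg₂ (· * ·) (matBank_apply A i e) (matBank_apply p j e)

lemma signedRow_of_le (α β π : ℕ → ℝ) {x σ e : ℕ} (hσ : σ < 3) (he : e ≤ d) :
    signedRow l q d α β π (3 * x + σ) e = hyperplaneRow l q d α β π x e := by
  rw [signedRow, if_neg (by omega), show (3 * x + σ) / 3 = x by omega]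

lemma signedRow_sign (α β π : ℕ → ℝ) {x σ : ℕ} (hσ : σ < 3) :
    signedRow l q d α β π (3 * x + σ) (d + 1) = (σ : ℝ) - 1 := by
  rw [signedRow, if_pos rfl, show (3 * x + σ) % 3 = σ by omega]

open RealRAM in
/-- If the rows selected by `w` determine a curve `T`, then its small points select the same set. -/
lemma eventually_selectsPoint_iff (w : ℕ → ℕ) (T : ℝ → Fin d → ℝ)
    (hdet : (normalMatrix d fun k => signedRow l q d (matBank A) (vecBank b) (matBank p) (w k)).det
      ≠ 0)
    (hT : ∀ ε j, (normalMatrix d fun k => signedRow l q d (matBank A) (vecBank b) (matBank p)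
        (w k)).mulVec (T ε) j - signedRow l q d (matBank A) (vecBank b) (matBank p) (w j) d =
      signedRow l q d (matBank A) (vecBank b) (matBank p) (w j) (d + 1) * ε ^ ((j : ℕ) + 1)) :
    ∀ᶠ ε in 𝓝[>] (0 : ℝ), ∀ j : Fin q,
      (SelectsPoint l d (signedRow l q d (matBank A) (vecBank b) (matBank p)) w j ↔
        ∀ i, A i ⬝ᵥ p j - b i < A i ⬝ᵥ T ε) := by
  have key : ∀ᶠ ε in 𝓝[>] (0 : ℝ), ∀ (j : Fin q) (i : Fin l),
      (LexPos (List.ofFn (rowCoeff d fun k =>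
        signedRow l q d (matBank A) (vecBank b) (matBank p)
          (if k < d then w k else 3 * (j * l + i)))) ↔ A i ⬝ᵥ p j - b i < A i ⬝ᵥ T ε) := by
    rw [eventually_all]
    intro j
    rw [eventually_all]
    intro i
    have h := eventually_lexPos_cellCoeff_iff hdet _ _ (A i) (A i ⬝ᵥ p j - b i) T hT
    filter_upwards [h] with ε hε
    rw [← hε]
    unfold rowCoeff
    -- The tested row is the signed copy number `0`; its sign entry is not used.
    have e0 : 3 * ((j : ℕ) * l + i) = 3 * (j * l + i) + 0 := rfl
    simp only [Fin.is_lt, if_true, lt_irrefl, if_false]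
    rw [e0, signedRow_of_le _ _ _ (by norm_num) le_rfl, hyperplaneRow_rhs]
    have e1 : (fun e : Fin d => signedRow l q d (matBank A) (vecBank b) (matBank p)
        (3 * (j * l + i) + 0) e) = A i := by
      funext e
      rw [signedRow_of_le _ _ _ (by norm_num) e.2.le, hyperplaneRow_normal]
    have e2 : (normalMatrix d fun k => signedRow l q d (matBank A) (vecBank b) (matBank p)
        (if k < d then w k else 3 * (j * l + i) + 0)) =
        normalMatrix d fun k => signedRow l q d (matBank A) (vecBank b) (matBank p) (w k) := by
      funext k e
      simp [normalMatrix]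
    rw [e1, e2]
  filter_upwards [key] with ε hε j
  constructor
  · intro h i
    exact (hε j i).1 (h i i.2)
  · intro h i hi
    exact (hε j ⟨i, hi⟩).2 (h ⟨i, hi⟩)

open RealRAM in
/-- The sets separated by an open polyhedron are those selected by bases of the hyperplanes. -/
theorem sepFamily_openPolyhedron_eq :
    SepFamily (openPolyhedron A b) (Set.range p) =
      {S | ∃ w : ℕ → ℕ, (∀ k < d, w k < 3 * (q * l + d)) ∧
        (normalMatrix d fun k => signedRow l q d (matBank A) (vecBank b) (matBank p) (w k)).det ≠ 0 ∧
        S = {x | ∃ j : Fin q, p j = x ∧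
          SelectsPoint l d (signedRow l q d (matBank A) (vecBank b) (matBank p)) w j}} := by
  set f := signedRow l q d (matBank A) (vecBank b) (matBank p) with hf
  have hset : ∀ (w : ℕ → ℕ) (t : Fin d → ℝ),
      (∀ j : Fin q, SelectsPoint l d f w j ↔ ∀ i, A i ⬝ᵥ p j - b i < A i ⬝ᵥ t) →
      sepPart (openPolyhedron A b) (Set.range p) t =
        {x | ∃ j : Fin q, p j = x ∧ SelectsPoint l d f w j} := by
    intro w t h
    ext x
    rw [mem_sepPart_openPolyhedron]
    constructor
    · rintro ⟨⟨j, rfl⟩, hx⟩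
      exact ⟨j, rfl, (h j).2 hx⟩
    · rintro ⟨j, rfl, hx⟩
      exact ⟨⟨j, rfl⟩, (h j).1 hx⟩
  ext S
  constructor
  · rintro ⟨t₀, rfl⟩
    let g : Fin (q * l + d) → ℕ → ℝ := fun h =>
      hyperplaneRow l q d (matBank A) (vecBank b) (matBank p) h
    let a : Fin (q * l + d) → (Fin d → ℝ) →ₗ[ℝ] ℝ := fun h =>
      dotProductBilin ℝ ℝ (fun e : Fin d => g h e)
    have ha : ∀ h x, a h x = (fun e : Fin d => g h e) ⬝ᵥ x := fun h x => rfl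
    -- The coordinate hyperplanes alone leave no common direction, whatever the rank of `A`.
    have hsep : ∀ x, (∀ h, a h x = 0) → x = 0 := by
      intro x hx
      funext k
      have := hx ⟨q * l + k, by omega⟩
      rw [ha] at this
      have e1 : (fun e : Fin d => g ⟨q * l + k, by omega⟩ e) = Pi.single k 1 := by
        funext e
        simp only [g, hyperplaneRow, Pi.single_apply]
        rw [if_neg (by omega)]
        simp [Fin.ext_iff]
      rw [e1, single_dotProduct, one_mul] at this
      exact this
    obtain ⟨h, s, T, -, hindep, hcurve, hev⟩ := exists_flag_of_cell d (by simp) a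
      (fun h => g h d) hsep t₀
    -- The sign picks one of the three copies of a hyperplane in the table.
    have hsgn : ∀ k, ∃ σ : ℕ, σ < 3 ∧ (s k : ℝ) = (σ : ℝ) - 1 := by
      intro k
      cases s k
      · exact ⟨1, by norm_num, by simp⟩
      · exact ⟨0, by norm_num, by simp⟩
      · exact ⟨2, by norm_num, by norm_num⟩
    choose σ hσ hσs using hsgn
    let w : ℕ → ℕ := fun k => if hk : k < d then 3 * h ⟨k, hk⟩ + σ ⟨k, hk⟩ else 0
    have hw : ∀ k : Fin d, w k = 3 * h k + σ k := fun k => by simp [w]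
    have hM : ∀ (k : Fin d) (e : ℕ), e ≤ d → f (w k) e = g (h k) e := by
      intro k e he
      rw [hw, hf, signedRow_of_le _ _ _ (hσ k) he]
    have hmul : ∀ (x : Fin d → ℝ) (k : Fin d),
        (normalMatrix d fun k => f (w k)).mulVec x k = a (h k) x := by
      intro x k
      rw [ha]
      show (fun e : Fin d => f (w k) e) ⬝ᵥ x = _
      congr 1
      funext e
      exact hM k e e.2.le
    have hdet : (normalMatrix d fun k => f (w k)).det ≠ 0 := by
      intro h0
      obtain ⟨x, hx0, hx⟩ := Matrix.exists_mulVec_eq_zero_iff.2 h0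
      exact hx0 (hindep x fun k => by rw [← hmul, hx]; rfl)
    refine ⟨w, ?_, hdet, ?_⟩
    · intro k hk
      have := hw ⟨k, hk⟩
      have h1 := (h ⟨k, hk⟩).2
      have h2 := hσ ⟨k, hk⟩
      simp only at this
      omega
    · have h1 := eventually_selectsPoint_iff A b p w T hdet (by
        intro ε j
        rw [← hf, hmul, hM j d le_rfl, hcurve, hσs, hw, hf, signedRow_sign _ _ _ (hσ j)])
      -- At one small `ε` the lexicographic tests are correct and `T ε` lies in the cell of `t₀`.
      obtain ⟨ε, hε, hε'⟩ := (h1.and hev).exists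
      apply hset
      intro j
      rw [hε]
      refine forall_congr' fun i => ?_
      have h2 := hε' ⟨j * l + i, (mul_add_lt_mul j.2 i.2).trans_le (Nat.le_add_right _ _)⟩
      have h3 : ∀ x, a ⟨j * l + i, (mul_add_lt_mul j.2 i.2).trans_le (Nat.le_add_right _ _)⟩ x =
          A i ⬝ᵥ x := by
        intro x
        rw [ha]
        congr 1
        funext e
        exact hyperplaneRow_normal A b p j i e
      have h4 : g ⟨j * l + i, (mul_add_lt_mul j.2 i.2).trans_le (Nat.le_add_right _ _)⟩ d =
          A i ⬝ᵥ p j - b i := hyperplaneRow_rhs A b p j i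
      rw [h3, h3, h4] at h2
      rw [← sub_pos, ← sign_eq_one_iff, h2, sign_eq_one_iff, sub_pos]
  · rintro ⟨w, -, hdet, rfl⟩
    -- Every nonsingular tuple defines a curve, and a point of it serves as the translation vector.
    let T : ℝ → Fin d → ℝ := fun ε => (normalMatrix d fun k => f (w k))⁻¹.mulVec
      fun j => f (w j) d + f (w j) (d + 1) * ε ^ ((j : ℕ) + 1)
    obtain ⟨ε, hε⟩ := (eventually_selectsPoint_iff A b p w T hdet (by
      intro ε j
      simp only [T, ← hf]
      rw [Matrix.mulVec_mulVec, Matrix.mul_nonsing_inv _ (isUnit_iff_ne_zero.2 hdet),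
        Matrix.one_mulVec]
      ring)).exists
    exact ⟨T ε, (hset w (T ε) hε).symm⟩

end Table

/-- From an interior point a small step along the normal `A i` stays in the polyhedron while raising
`A i ⬝ᵥ x` strictly. A zero row with `b i = 0` would break the equality. -/
lemma interior_closedPolyhedron {l d : ℕ} (A : Matrix (Fin l) (Fin d) ℝ) (b : Fin l → ℝ)
    (hA : ∀ i, A i ≠ 0) : interior (closedPolyhedron A b) = openPolyhedron A b := by
  apply subset_antisymm
  · intro x hx i
    have hcont : Continuous fun ε : ℝ => x + ε • A i := by fun_prop
    have hev : ∀ᶠ ε in 𝓝[>] (0 : ℝ), x + ε • A i ∈ closedPolyhedron A b := by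
      apply Filter.Eventually.filter_mono nhdsWithin_le_nhds
      refine hcont.continuousAt.eventually ?_
      have h0 : x + (0 : ℝ) • A i = x := by simp
      show ∀ᶠ y in 𝓝 (x + (0 : ℝ) • A i), y ∈ closedPolyhedron A b
      rw [h0]
      exact mem_interior_iff_mem_nhds.1 hx
    obtain ⟨ε, hε, hε0⟩ := (hev.and eventually_mem_nhdsWithin).exists
    have h1 : A i ⬝ᵥ (x + ε • A i) ≤ b i := hε i
    rw [dotProduct_add, dotProduct_smul, smul_eq_mul] at h1
    have h2 : 0 < A i ⬝ᵥ A i := by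
      refine lt_of_le_of_ne (Finset.sum_nonneg fun k _ => mul_self_nonneg _) fun h => hA i ?_
      exact dotProduct_self_eq_zero.1 h.symm
    have h3 := mul_pos (show 0 < ε from hε0) h2
    show A i ⬝ᵥ x < b i
    linarith
  · apply interior_maximal
    · intro x hx i
      exact (hx i).le
    · have : openPolyhedron A b = ⋂ i, {x | A.mulVec x i < b i} := by
        ext x
        simp [openPolyhedron]
      rw [this]
      refine isOpen_iInter_of_finite fun i => isOpen_lt ?_ continuous_const
      unfold Matrix.mulVec dotProduct
      fun_prop

namespace RealRAM

/-! ### Program logic with cost bounds. -/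

section Logic

/-- Started in `s`, the program `c` halts within `K` operations in a state satisfying `Q`. -/
def Runs (c : Program) (s : State) (K : ℕ) (Q : State → Prop) : Prop :=
  ∃ t n, Exec c s t n ∧ n ≤ K ∧ Q t

@[simp] lemma State.setReg_reg (s : State) (x y : ℕ) (v : ℝ) :
    (s.setReg x v).reg y = if y = x then v else s.reg y := by
  simp [State.setReg, Function.update_apply]

@[simp] lemma State.setReg_bank (s : State) (x : ℕ) (v : ℝ) : (s.setReg x v).bank = s.bank := rfl

@[simp] lemma State.setBank_reg (s : State) (a i : ℕ) (v : ℝ) : (s.setBank a i v).reg = s.reg := rfl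

lemma State.setBank_bank (s : State) (a a' i i' : ℕ) (v : ℝ) :
    (s.setBank a i v).bank a' i' = if a' = a ∧ i' = i then v else s.bank a' i' := by
  by_cases h : a' = a
  · subst h
    simp [State.setBank, Function.update_apply]
  · simp [State.setBank, h]

lemma State.setBank_bank_of_ne (s : State) {a a' : ℕ} (i : ℕ) (v : ℝ) (h : a' ≠ a) :
    (s.setBank a i v).bank a' = s.bank a' := by
  funext i'
  simp [State.setBank_bank, h]

variable {c c₁ c₂ : Program} {s : State} {K K₁ K₂ : ℕ} {Q Q₁ : State → Prop}

lemma Runs.mono (h : Runs c s K Q) (hK : K ≤ K₁) (hQ : ∀ t, Q t → Q₁ t) : Runs c s K₁ Q₁ := by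
  obtain ⟨t, n, he, hn, hq⟩ := h
  exact ⟨t, n, he, hn.trans hK, hQ t hq⟩

lemma Runs.weaken (h : Runs c s K Q) (hQ : ∀ t, Q t → Q₁ t) : Runs c s K Q₁ := h.mono le_rfl hQ

lemma Runs.skip (h : Q s) : Runs .skip s 0 Q := ⟨_, _, .skip s, le_rfl, h⟩

lemma Runs.const {x : ℕ} {z : ℤ} (h : Q (s.setReg x z)) : Runs (.const x z) s 1 Q :=
  ⟨_, _, .const s x z, le_rfl, h⟩

lemma Runs.copy {x y : ℕ} (h : Q (s.setReg x (s.reg y))) : Runs (.copy x y) s 1 Q :=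
  ⟨_, _, .copy s x y, le_rfl, h⟩

lemma Runs.add {x y z : ℕ} (h : Q (s.setReg x (s.reg y + s.reg z))) :
    Runs (.arith .add x y z) s 1 Q :=
  ⟨_, _, .add s x y z, le_rfl, h⟩

lemma Runs.mul {x y z : ℕ} (h : Q (s.setReg x (s.reg y * s.reg z))) :
    Runs (.arith .mul x y z) s 1 Q :=
  ⟨_, _, .mul s x y z, le_rfl, h⟩

lemma Runs.load {x a y i : ℕ} (hi : s.reg y = i) (h : Q (s.setReg x (s.bank a i))) :
    Runs (.load x a y) s 1 Q :=
  ⟨_, _, .load s x a y i hi, le_rfl, h⟩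

lemma Runs.store {a x y i : ℕ} (hi : s.reg x = i) (h : Q (s.setBank a i (s.reg y))) :
    Runs (.store a x y) s 1 Q :=
  ⟨_, _, .store s a x y i hi, le_rfl, h⟩

lemma Runs.seq (h : Runs c₁ s K₁ fun t => Runs c₂ t K₂ Q) : Runs (.seq c₁ c₂) s (K₁ + K₂) Q := by
  obtain ⟨t, m, h₁, hm, u, n, h₂, hn, hq⟩ := h
  exact ⟨u, m + n, .seq _ _ _ _ _ _ _ h₁ h₂, by omega, hq⟩

lemma Runs.ite {b : Test} (h₁ : b.Holds s → Runs c₁ s K Q) (h₂ : ¬ b.Holds s → Runs c₂ s K Q) :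
    Runs (.ite b c₁ c₂) s (K + 1) Q := by
  by_cases hb : b.Holds s
  · obtain ⟨t, n, h, hn, hq⟩ := h₁ hb
    exact ⟨t, n + 1, .iteTrue _ _ _ _ _ _ hb h, by omega, hq⟩
  · obtain ⟨t, n, h, hn, hq⟩ := h₂ hb
    exact ⟨t, n + 1, .iteFalse _ _ _ _ _ _ hb h, by omega, hq⟩

/-- `for reg x := 0, 1, …, reg y - 1 do c`, where register `4` holds `1`. -/
def Program.count (x y : ℕ) (c : Program) : Program :=
  .seq (.const x 0) (.loop (.lt x y) (.seq c (.arith .add x x 4)))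

/-- Each round pays for the body, the increment and the comparison; the last `2` is the
initialisation and the failing comparison. By `hInv` the invariant ignores the counter, so
incrementing it is harmless. -/
lemma Runs.count {x y n : ℕ} (hx4 : x ≠ 4) (hxy : x ≠ y) (Inv : ℕ → State → Prop)
    (hInv : ∀ i t v, Inv i t → Inv i (t.setReg x v))
    (hbody : ∀ i < n, ∀ t, Inv i t → t.reg x = i → t.reg y = n → t.reg 4 = 1 →
      Runs c t K fun u => Inv (i + 1) u ∧ u.reg x = i ∧ u.reg y = n ∧ u.reg 4 = 1)
    (h0 : Inv 0 s) (hy : s.reg y = n) (h4 : s.reg 4 = 1) :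
    Runs (.count x y c) s (n * (K + 2) + 2) fun u => Inv n u ∧ u.reg y = n ∧ u.reg 4 = 1 := by
  have key : ∀ k i t, i + k = n → Inv i t → t.reg x = i → t.reg y = n → t.reg 4 = 1 →
      Runs (.loop (.lt x y) (.seq c (.arith .add x x 4))) t (k * (K + 2) + 1)
        fun u => Inv n u ∧ u.reg y = n ∧ u.reg 4 = 1 := by
    intro k
    induction k with
    | zero =>
      intro i t hi hI hx hy h4
      refine ⟨t, 1, .loopDone _ _ _ ?_, by omega, ?_, hy, h4⟩
      · simp only [Test.Holds, hx, hy]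
        simp only [Nat.cast_lt]
        omega
      · rwa [← show i = n by omega]
    | succ k ih =>
      intro i t hi hI hx hy h4
      obtain ⟨u, m, he, hm, hIu, hux, huy, hu4⟩ := hbody i (by omega) t hI hx hy h4
      obtain ⟨v, m', he', hm', hv⟩ := ih (i + 1) (u.setReg x (u.reg x + u.reg 4)) (by omega)
        (hInv _ _ _ hIu) (by simp [hux, hu4]) (by simp [hxy.symm, huy]) (by simp [hx4.symm, hu4])
      refine ⟨v, m + 1 + m' + 1, .loopStep _ _ _ _ _ _ _ ?_ (.seq _ _ _ _ _ _ _ he (.add _ _ _ _))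
        he', ?_, hv⟩
      · simp only [Test.Holds, hx, hy]
        simp only [Nat.cast_lt]
        omega
      · have : (k + 1) * (K + 2) = k * (K + 2) + K + 2 := by ring
        omega
  have : n * (K + 2) + 2 = 1 + (n * (K + 2) + 1) := by omega
  rw [this]
  exact Runs.seq (Runs.const (key n 0 _ (by omega) (hInv _ _ _ h0) (by simp)
    (by simp [hxy.symm, hy]) (by simp [hx4.symm, h4])))

end Logic

/-! ### Compiling fixed expressions. -/

section Realizable

/-- The function `f` of the registers below `V` can be computed by a program with bounded running
time, in any register `r ≥ V` and without overwriting registers below `r`. -/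
structure Realizable (V : ℕ) (f : (ℕ → ℝ) → ℝ) : Prop where
  congr : ∀ ρ ρ' : ℕ → ℝ, (∀ x < V, ρ x = ρ' x) → f ρ = f ρ'
  exists_program : ∀ r, V ≤ r → ∃ (c : Program) (K : ℕ), ∀ s : State, Runs c s K fun t =>
    t.reg r = f s.reg ∧ (∀ x < r, t.reg x = s.reg x) ∧ t.bank = s.bank

variable {V : ℕ} {f g : (ℕ → ℝ) → ℝ}

lemma Realizable.intCast (z : ℤ) : Realizable V fun _ => (z : ℝ) := by
  refine ⟨fun _ _ _ => rfl, fun r _ => ⟨.const r z, 1, fun s => Runs.const ⟨by simp, ?_, rfl⟩⟩⟩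
  intro x hx
  simp [hx.ne]

lemma Realizable.zero : Realizable V fun _ => 0 := by
  simpa using Realizable.intCast (V := V) 0

lemma Realizable.one : Realizable V fun _ => 1 := by
  simpa using Realizable.intCast (V := V) 1

lemma Realizable.reg {x : ℕ} (hx : x < V) : Realizable V fun ρ => ρ x := by
  refine ⟨fun _ _ h => h x hx, fun r _ => ⟨.copy r x, 1, fun s => Runs.copy ⟨by simp, ?_, rfl⟩⟩⟩
  intro y hy
  simp [hy.ne]

/-- Registers from `r` on act as a stack: `f` is left in `r` while `g` is computed in `r + 1`. The
field `congr` guarantees that `g` still sees its original inputs. -/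
lemma Realizable.arith (o : Op) (op : ℝ → ℝ → ℝ)
    (ho : ∀ s x y z (Q : State → Prop), Q (s.setReg x (op (s.reg y) (s.reg z))) →
      Runs (.arith o x y z) s 1 Q)
    (hf : Realizable V f) (hg : Realizable V g) : Realizable V fun ρ => op (f ρ) (g ρ) := by
  refine ⟨fun ρ ρ' h => by simp only [hf.congr ρ ρ' h, hg.congr ρ ρ' h], fun r hr => ?_⟩
  obtain ⟨c₁, K₁, h₁⟩ := hf.exists_program r hr
  obtain ⟨c₂, K₂, h₂⟩ := hg.exists_program (r + 1) (by omega)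
  refine ⟨.seq c₁ (.seq c₂ (.arith o r r (r + 1))), K₁ + (K₂ + 1), fun s => ?_⟩
  refine Runs.seq ((h₁ s).weaken fun t ⟨ht, htr, htb⟩ => Runs.seq ((h₂ t).weaken
    fun u ⟨hu, hur, hub⟩ => ho _ _ _ _ _ ⟨?_, ?_, ?_⟩))
  · rw [State.setReg_reg, if_pos rfl, hu, hur r (by omega), ht,
      hg.congr t.reg s.reg fun x hx => htr x (by omega)]
  · intro x hx
    rw [State.setReg_reg, if_neg hx.ne, hur x (by omega), htr x hx]
  · rw [State.setReg_bank, hub, htb]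

lemma Realizable.add (hf : Realizable V f) (hg : Realizable V g) :
    Realizable V fun ρ => f ρ + g ρ :=
  Realizable.arith .add (· + ·) (fun _ _ _ _ _ h => Runs.add h) hf hg

lemma Realizable.mul (hf : Realizable V f) (hg : Realizable V g) :
    Realizable V fun ρ => f ρ * g ρ :=
  Realizable.arith .mul (· * ·) (fun _ _ _ _ _ h => Runs.mul h) hf hg

lemma Realizable.sub (hf : Realizable V f) (hg : Realizable V g) :
    Realizable V fun ρ => f ρ - g ρ :=
  Realizable.arith .sub (· - ·) (fun _ _ _ _ _ h => ⟨_, _, .sub _ _ _ _, le_rfl, h⟩) hf hg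

lemma Realizable.sum {ι : Type*} {f : ι → (ℕ → ℝ) → ℝ} (S : Finset ι)
    (hf : ∀ i ∈ S, Realizable V (f i)) : Realizable V fun ρ => ∑ i ∈ S, f i ρ := by
  classical
  induction S using Finset.induction_on with
  | empty => simpa using Realizable.zero
  | insert i S hi ih =>
    simp only [Finset.sum_insert hi]
    exact (hf i (by simp)).add (ih fun j hj => hf j (by simp [hj]))

lemma Realizable.prod {ι : Type*} {f : ι → (ℕ → ℝ) → ℝ} (S : Finset ι)
    (hf : ∀ i ∈ S, Realizable V (f i)) : Realizable V fun ρ => ∏ i ∈ S, f i ρ := by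
  classical
  induction S using Finset.induction_on with
  | empty => simpa using Realizable.one
  | insert i S hi ih =>
    simp only [Finset.prod_insert hi]
    exact (hf i (by simp)).mul (ih fun j hj => hf j (by simp [hj]))

/-- The Leibniz expansion suffices: its size depends only on `n`. -/
lemma Realizable.det {n : ℕ} {M : (ℕ → ℝ) → Matrix (Fin n) (Fin n) ℝ}
    (hM : ∀ i j, Realizable V fun ρ => M ρ i j) : Realizable V fun ρ => (M ρ).det := by
  simp only [Matrix.det_apply']
  exact Realizable.sum _ fun σ _ => (Realizable.intCast _).mul (Realizable.prod _ fun i _ => hM _ _)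

lemma Realizable.adjugate {n : ℕ} {M : (ℕ → ℝ) → Matrix (Fin n) (Fin n) ℝ}
    (hM : ∀ i j, Realizable V fun ρ => M ρ i j) (i j : Fin n) :
    Realizable V fun ρ => (M ρ).adjugate i j := by
  simp only [Matrix.adjugate_apply]
  refine Realizable.det fun i' j' => ?_
  simp only [Matrix.updateRow_apply]
  split_ifs
  · by_cases h : j' = i
    · subst h
      simpa using Realizable.one
    · simpa [Pi.single_apply, h] using Realizable.zero
  · exact hM _ _

open Classical in
-- The verdict on the tail is computed first; the head overrides it unless it is zero, in which case
-- `copy r r` leaves it alone.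
lemma Realizable.lexPos (L : List ((ℕ → ℝ) → ℝ)) (hL : ∀ f ∈ L, Realizable V f) :
    Realizable V fun ρ => if LexPos (L.map fun f => f ρ) then 1 else 0 := by
  induction L with
  | nil => simpa [LexPos] using Realizable.zero
  | cons f L ih =>
    have hf := hL f (by simp)
    have hg := ih fun g hg => hL g (by simp [hg])
    refine ⟨fun ρ ρ' h => ?_, fun r hr => ?_⟩
    · have : (f :: L).map (fun f => f ρ) = (f :: L).map fun f => f ρ' :=
        List.map_congr_left fun g hg => (hL g hg).congr ρ ρ' h
      rw [this]
    obtain ⟨c₁, K₁, h₁⟩ := hg.exists_program r hr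
    obtain ⟨c₂, K₂, h₂⟩ := hf.exists_program (r + 1) (by omega)
    refine ⟨.seq c₁ (.seq c₂ (.seq (.const (r + 2) 0) (.ite (.lt (r + 2) (r + 1)) (.const r 1)
      (.ite (.lt (r + 1) (r + 2)) (.const r 0) (.copy r r))))), K₁ + (K₂ + (1 + (2 + 1))),
      fun s => ?_⟩
    refine Runs.seq ((h₁ s).weaken fun t ⟨ht, htr, htb⟩ => Runs.seq ((h₂ t).weaken
      fun u ⟨hu, hur, hub⟩ => Runs.seq (Runs.const ?_)))
    have hfr : u.reg (r + 1) = f s.reg := by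
      rw [hu, hf.congr t.reg s.reg fun x hx => htr x (by omega)]
    have hgr : u.reg r = if LexPos (L.map fun f => f s.reg) then 1 else 0 := by
      rw [hur r (by omega), ht]
    have hreg : ∀ x < r, u.reg x = s.reg x := fun x hx => by rw [hur x (by omega), htr x hx]
    refine Runs.ite (fun hlt => ?_) fun hlt => ?_
    · have hlt' : 0 < f s.reg := by simpa [Test.Holds, hfr] using hlt
      refine (Runs.const ⟨?_, ?_, ?_⟩).mono (by omega : 1 ≤ 2) fun _ h => h
      · simp [LexPos, hlt']
      · intro x hx
        simp [hx.ne, (show x ≠ r + 2 by omega), hreg x hx]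
      · simp [hub, htb]
    · have hlt' : ¬ 0 < f s.reg := by simpa [Test.Holds, hfr] using hlt
      refine Runs.ite (fun hgt => ?_) fun hgt => ?_
      · have hgt' : f s.reg < 0 := by simpa [Test.Holds, hfr] using hgt
        refine Runs.const ⟨?_, ?_, ?_⟩
        · simp [LexPos, hlt', hgt'.ne]
        · intro x hx
          simp [hx.ne, (show x ≠ r + 2 by omega), hreg x hx]
        · simp [hub, htb]
      · have hgt' : ¬ f s.reg < 0 := by simpa [Test.Holds, hfr] using hgt
        refine Runs.copy ⟨?_, ?_, ?_⟩
        · simp [LexPos, le_antisymm (not_lt.1 hlt') (not_lt.1 hgt'), hgr]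
        · intro x hx
          simp [hx.ne, (show x ≠ r + 2 by omega), hreg x hx]
        · simp [hub, htb]

lemma Realizable.cellCoeff {d : ℕ} {M : (ℕ → ℝ) → Matrix (Fin d) (Fin d) ℝ}
    {c s a : (ℕ → ℝ) → Fin d → ℝ} {γ : (ℕ → ℝ) → ℝ}
    (hM : ∀ i j, Realizable V fun ρ => M ρ i j) (hc : ∀ i, Realizable V fun ρ => c ρ i)
    (hs : ∀ i, Realizable V fun ρ => s ρ i) (ha : ∀ i, Realizable V fun ρ => a ρ i)
    (hγ : Realizable V γ) (k : Fin (d + 1)) :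
    Realizable V fun ρ => cellCoeff (M ρ) (c ρ) (s ρ) (a ρ) (γ ρ) k := by
  have hv : ∀ j, Realizable V fun ρ => Matrix.vecMul (a ρ) (M ρ).adjugate j := fun j =>
    Realizable.sum Finset.univ fun i _ => (ha i).mul (Realizable.adjugate hM i j)
  have hdet := Realizable.det hM
  refine Fin.cases ?_ (fun j => ?_) k
  · simp only [_root_.cellCoeff, Fin.cons_zero]
    exact hdet.mul ((Realizable.sum _ fun j _ => (hv j).mul (hc j)).sub (hγ.mul hdet))
  · simp only [_root_.cellCoeff, Fin.cons_succ]
    exact hdet.mul ((hv j).mul (hs j))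

end Realizable

/-! ### Moving rows between banks and registers. -/

section Transfer

/-- `reg (dst + e) := bank a [reg idx * D + e]` for `e < n`. -/
def Program.loadRun (a idx D dst : ℕ) : ℕ → Program
  | 0 => .skip
  | n + 1 => .seq (loadRun a idx D dst n) (.seq (.const 5 D) (.seq (.arith .mul 5 idx 5)
      (.seq (.const 6 n) (.seq (.arith .add 5 5 6) (.load (dst + n) a 5)))))

/-- `bank a [reg idx * D + e] := reg (src + e)` for `e < n`. -/
def Program.storeRun (a idx D src : ℕ) : ℕ → Program
  | 0 => .skip
  | n + 1 => .seq (storeRun a idx D src n) (.seq (.const 5 D) (.seq (.arith .mul 5 idx 5)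
      (.seq (.const 6 n) (.seq (.arith .add 5 5 6) (.store a 5 (src + n))))))

/-- The index register is read anew for every entry, so it must avoid the destination and the
scratch registers `5` and `6`, which form the address. -/
lemma Runs.loadRun {a idx D dst n r : ℕ} (hdst : 6 < dst) (h5 : idx ≠ 5) (h6 : idx ≠ 6)
    (hidx : idx < dst ∨ dst + n ≤ idx) {s : State} (hr : s.reg idx = r) :
    Runs (.loadRun a idx D dst n) s (n * 5) fun t =>
      (∀ e < n, t.reg (dst + e) = s.bank a (r * D + e)) ∧
      (∀ x, x ≠ 5 → x ≠ 6 → (x < dst ∨ dst + n ≤ x) → t.reg x = s.reg x) ∧ t.bank = s.bank := by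
  induction n with
  | zero => exact Runs.skip ⟨by simp, by simp, rfl⟩
  | succ n ih =>
    rw [add_mul, one_mul]
    refine Runs.seq ((ih (by omega)).weaken fun t ⟨ht, htx, htb⟩ => ?_)
    refine Runs.seq (K₁ := 1) (K₂ := 4) (Runs.const (Runs.seq (K₁ := 1) (K₂ := 3) (Runs.mul
      (Runs.seq (K₁ := 1) (K₂ := 2) (Runs.const (Runs.seq (K₁ := 1) (K₂ := 1) (Runs.add
        (Runs.load (i := r * D + n) ?_ ⟨?_, ?_, ?_⟩))))))))
    · simp [h5, htx idx h5 h6 (by omega), hr]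
    · intro e he
      rcases (show e < n ∨ e = n by omega) with h | rfl
      · simp [h.ne, ht e h, (show dst + e ≠ 5 by omega), (show dst + e ≠ 6 by omega)]
      · simp [htb]
    · intro x h5 h6 hx
      simp [h5, h6, (show x ≠ dst + n by omega), htx x h5 h6 (by omega)]
    · simp [htb]

lemma Runs.storeRun {a idx D src n r : ℕ} (hsrc : 6 < src) (h5 : idx ≠ 5) (h6 : idx ≠ 6)
    {s : State} (hr : s.reg idx = r) :
    Runs (.storeRun a idx D src n) s (n * 5) fun t =>
      (∀ e < n, t.bank a (r * D + e) = s.reg (src + e)) ∧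
      (∀ y, (y < r * D ∨ r * D + n ≤ y) → t.bank a y = s.bank a y) ∧
      (∀ a', a' ≠ a → t.bank a' = s.bank a') ∧ ∀ x, x ≠ 5 → x ≠ 6 → t.reg x = s.reg x := by
  induction n with
  | zero => exact Runs.skip ⟨by simp, by simp, by simp, by simp⟩
  | succ n ih =>
    rw [add_mul, one_mul]
    refine Runs.seq (ih.weaken fun t ⟨ht, hty, htb, htx⟩ => ?_)
    refine Runs.seq (K₁ := 1) (K₂ := 4) (Runs.const (Runs.seq (K₁ := 1) (K₂ := 3) (Runs.mul
      (Runs.seq (K₁ := 1) (K₂ := 2) (Runs.const (Runs.seq (K₁ := 1) (K₂ := 1) (Runs.add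
        (Runs.store (i := r * D + n) ?_ ⟨?_, ?_, ?_, ?_⟩))))))))
    · simp [h5, htx idx h5 h6, hr]
    · intro e he
      rcases (show e < n ∨ e = n by omega) with h | rfl
      · simp [State.setBank_bank, h.ne, ht e h]
      · simp [State.setBank_bank, (show src + e ≠ 5 by omega), (show src + e ≠ 6 by omega),
          htx (src + e) (by omega) (by omega)]
    · intro y hy
      rw [State.setBank_bank, if_neg (by omega)]
      simp only [State.setReg_bank]
      exact hty y (by omega)
    · intro a' ha'
      rw [State.setBank_bank_of_ne _ _ _ ha']
      simp only [State.setReg_bank]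
      exact htb a' ha'
    · intro x h5 h6
      simp [h5, h6, htx x h5 h6]

end Transfer

end RealRAM

namespace RealRAM

/-! ### Storage layout. -/

section Layout

/-- Register `e` of the `k`-th block of `d + 3` registers. Entries `0, …, d + 1` of a block hold a
row of the table, entry `d + 2` its number. -/
def blockReg (d k e : ℕ) : ℕ := 20 + k * (d + 3) + e

lemma blockReg_add (d k e : ℕ) : blockReg d k 0 + e = blockReg d k e := rfl

/-- Keeps the blocks apart from the registers with fixed roles: `0`, `1` for `l`, `q`; `2` for the
list length; `3` for the table length; `4` for the constant `1`; `5`, `6` for scratch; `7`, `8` for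
the indices `i`, `j`; `9` for the current bit. -/
lemma le_blockReg (d k e : ℕ) : 20 ≤ blockReg d k e := by
  unfold blockReg
  omega

lemma blockReg_lt_of_lt {d k k' e : ℕ} (hk : k < k') (he : e < d + 3) (e' : ℕ) :
    blockReg d k e < blockReg d k' e' := by
  have : (k + 1) * (d + 3) ≤ k' * (d + 3) := Nat.mul_le_mul_right _ hk
  rw [add_mul, one_mul] at this
  unfold blockReg
  omega

/-- The first `n` rows of `f` are stored in bank `4`, and register `3` holds `n`. -/
def Filled (d : ℕ) (f : ℕ → ℕ → ℝ) (n : ℕ) (s : State) : Prop :=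
  s.reg 3 = n ∧ ∀ r < n, ∀ e < d + 2, s.bank 4 (r * (d + 2) + e) = f r e

lemma Filled.of_eq {d n : ℕ} {f : ℕ → ℕ → ℝ} {s t : State} (h : Filled d f n s)
    (hr : t.reg 3 = s.reg 3) (hb : t.bank 4 = s.bank 4) : Filled d f n t := by
  rw [Filled, hr, hb]
  exact h

end Layout

/-! ### Writing the table of signed hyperplanes. -/

section Fill

/-- Append the content of block `d` to the table, with last entry `z`. -/
def Program.pushRow (d : ℕ) (z : ℤ) : Program :=
  .seq (.const (blockReg d d (d + 1)) z)
    (.seq (.storeRun 4 3 (d + 2) (blockReg d d 0) (d + 2)) (.arith .add 3 3 4))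

/-- Append the content of block `d` to the table, with last entries `-1`, `0` and `1`. -/
def Program.pushRows (d : ℕ) : Program :=
  .seq (.pushRow d (-1)) (.seq (.pushRow d 0) (.pushRow d 1))

lemma Runs.pushRow {d n : ℕ} {z : ℤ} {f : ℕ → ℕ → ℝ} {s : State} (h4 : s.reg 4 = 1)
    (hs : Filled d f n s) (hrow : ∀ e ≤ d, s.reg (blockReg d d e) = f n e) (hz : f n (d + 1) = z) :
    Runs (.pushRow d z) s ((d + 2) * 5 + 2) fun t => Filled d f (n + 1) t ∧
      (∀ a, a ≠ 4 → t.bank a = s.bank a) ∧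
      ∀ x, x ≠ 3 → x ≠ 5 → x ≠ 6 → x ≠ blockReg d d (d + 1) → t.reg x = s.reg x := by
  have hb := le_blockReg d d
  have e1 : (d + 2) * 5 + 2 = 1 + ((d + 2) * 5 + 1) := by omega
  rw [e1]
  refine Runs.seq (Runs.const (Runs.seq ((Runs.storeRun (r := n) (by have := hb 0; omega)
    (by omega) (by omega) ?_).weaken fun t ⟨ht, hty, htb, htx⟩ => Runs.add ⟨⟨?_, ?_⟩, ?_, ?_⟩)))
  · have := hb (d + 1)
    simp [(show 3 ≠ blockReg d d (d + 1) by omega), hs.1]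
  · have := hb (d + 1)
    simp [htx, (show 3 ≠ blockReg d d (d + 1) by omega),
      (show 4 ≠ blockReg d d (d + 1) by omega), hs.1, h4]
  · intro r hr e he
    rw [State.setReg_bank]
    rcases (show r < n ∨ r = n by omega) with h | rfl
    · rw [hty, State.setReg_bank, hs.2 r h e he]
      left
      calc r * (d + 2) + e < r * (d + 2) + (d + 2) := by omega
        _ = (r + 1) * (d + 2) := by ring
        _ ≤ n * (d + 2) := Nat.mul_le_mul_right _ h
    · rw [ht e he, blockReg_add, State.setReg_reg]
      rcases (show e ≤ d ∨ e = d + 1 by omega) with h | rfl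
      · rw [if_neg (by unfold blockReg; omega), hrow e h]
      · rw [if_pos rfl, hz]
  · intro a ha
    simp [htb a ha]
  · intro x h3 h5 h6 hx
    simp [h3, htx x h5 h6, hx]

variable {l q d : ℕ} {α β π : ℕ → ℝ}

/-- Pushing changes only the sign entry of block `d`, so the same normal and right-hand side can be
stored three times. -/
lemma Runs.pushRows {x : ℕ} {s : State} (h4 : s.reg 4 = 1)
    (hs : Filled d (signedRow l q d α β π) (3 * x) s)
    (hrow : ∀ e ≤ d, s.reg (blockReg d d e) = hyperplaneRow l q d α β π x e) :
    Runs (.pushRows d) s (3 * ((d + 2) * 5 + 2)) fun t =>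
      Filled d (signedRow l q d α β π) (3 * (x + 1)) t ∧
      (∀ a, a ≠ 4 → t.bank a = s.bank a) ∧
      ∀ y, y ≠ 3 → y ≠ 5 → y ≠ 6 → y ≠ blockReg d d (d + 1) → t.reg y = s.reg y := by
  have hb := le_blockReg d d
  have e1 : 3 * ((d + 2) * 5 + 2) =
    ((d + 2) * 5 + 2) + (((d + 2) * 5 + 2) + ((d + 2) * 5 + 2)) := by omega
  have hne4 : 4 ≠ blockReg d d (d + 1) := by have := hb (d + 1); omega
  have hne : ∀ e ≤ d, ∀ u v : State, (∀ y, y ≠ 3 → y ≠ 5 → y ≠ 6 → y ≠ blockReg d d (d + 1) →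
      v.reg y = u.reg y) → v.reg (blockReg d d e) = u.reg (blockReg d d e) := by
    intro e he u v h
    have := hb e
    exact h _ (by omega) (by omega) (by omega) (by unfold blockReg; omega)
  rw [e1]
  have hrow' : ∀ σ < 3, ∀ e ≤ d, s.reg (blockReg d d e) = signedRow l q d α β π (3 * x + σ) e :=
    fun σ hσ e he => by rw [hrow e he, signedRow_of_le _ _ _ hσ he]
  have hsign : ∀ σ < 3, signedRow l q d α β π (3 * x + σ) (d + 1) = (σ : ℝ) - 1 :=
    fun σ hσ => signedRow_sign α β π hσ
  refine Runs.seq ((Runs.pushRow (n := 3 * x + 0) h4 hs (hrow' 0 (by norm_num))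
    (by rw [hsign 0 (by norm_num)]; norm_num)).weaken fun t ⟨htf, htb, htx⟩ => ?_)
  refine Runs.seq ((Runs.pushRow (n := 3 * x + 1)
    (by rw [htx 4 (by omega) (by omega) (by omega) hne4, h4]) htf
    (fun e he => by rw [hne e he _ _ htx, hrow' 1 (by norm_num) e he])
    (by rw [hsign 1 (by norm_num)]; norm_num)).weaken fun u ⟨huf, hub, hux⟩ => ?_)
  refine (Runs.pushRow (n := 3 * x + 2) (by rw [hux 4 (by omega) (by omega) (by omega) hne4,
    htx 4 (by omega) (by omega) (by omega) hne4, h4]) huf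
    (fun e he => by rw [hne e he _ _ hux, hne e he _ _ htx, hrow' 2 (by norm_num) e he])
    (by rw [hsign 2 (by norm_num)]; norm_num)).weaken fun v ⟨hvf, hvb, hvx⟩ => ?_
  refine ⟨hvf, fun a ha => ?_, fun y h3 h5 h6 hy => ?_⟩
  · rw [hvb a ha, hub a ha, htb a ha]
  · rw [hvx y h3 h5 h6 hy, hux y h3 h5 h6 hy, htx y h3 h5 h6 hy]

/-- Append the rows of the hyperplane `A_i t = A_i p_j - b_i`, where registers `7` and `8` hold `i`
and `j`; `c` computes the right-hand side. -/
def Program.pushHyperplane (d : ℕ) (c : Program) : Program :=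
  .seq (.loadRun 0 7 d (blockReg d d 0) d) (.seq (.loadRun 2 8 d (blockReg d (d + 1) 0) d)
    (.seq (.loadRun 1 7 1 (blockReg d (d + 1) d) 1) (.seq c
      (.seq (.copy (blockReg d d d) (blockReg d (d + 2) 0)) (.pushRows d)))))

lemma exists_program_rhs (d : ℕ) : ∃ (c : Program) (K : ℕ), ∀ s : State, Runs c s K fun t =>
    t.reg (blockReg d (d + 2) 0) = ∑ e ∈ Finset.range d,
      s.reg (blockReg d d e) * s.reg (blockReg d (d + 1) e) - s.reg (blockReg d (d + 1) d) ∧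
    (∀ x < blockReg d (d + 2) 0, t.reg x = s.reg x) ∧ t.bank = s.bank := by
  have h : Realizable (blockReg d (d + 2) 0) fun ρ => ∑ e ∈ Finset.range d,
      ρ (blockReg d d e) * ρ (blockReg d (d + 1) e) - ρ (blockReg d (d + 1) d) := by
    refine (Realizable.sum _ fun e he => ?_).sub
      (.reg (blockReg_lt_of_lt (by omega) (by omega) _))
    have := Finset.mem_range.1 he
    exact (Realizable.reg (blockReg_lt_of_lt (by omega) (by omega) _)).mul
      (.reg (blockReg_lt_of_lt (by omega) (by omega) _))
  exact h.exists_program _ le_rfl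

lemma exists_runs_pushHyperplane (d : ℕ) : ∃ (c : Program) (K : ℕ), ∀ (l q i j : ℕ) (s : State),
    i < l → j < q → s.reg 4 = 1 → s.reg 7 = i → s.reg 8 = j →
    Filled d (signedRow l q d (s.bank 0) (s.bank 1) (s.bank 2)) (3 * (j * l + i)) s →
    Runs (.pushHyperplane d c) s K fun t =>
      Filled d (signedRow l q d (s.bank 0) (s.bank 1) (s.bank 2)) (3 * (j * l + (i + 1))) t ∧
      (∀ a, a ≠ 4 → t.bank a = s.bank a) ∧
      ∀ y < 20, y ≠ 3 → y ≠ 5 → y ≠ 6 → t.reg y = s.reg y := by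
  obtain ⟨c, K, hc⟩ := exists_program_rhs d
  refine ⟨c, d * 5 + (d * 5 + (1 * 5 + (K + (1 + 3 * ((d + 2) * 5 + 2))))),
    fun l q i j s hi hj h4 h7 h8 hs => ?_⟩
  have hb := le_blockReg d
  have hb1 : ∀ e < d + 3, ∀ e', blockReg d d e < blockReg d (d + 1) e' := fun e he e' =>
    blockReg_lt_of_lt (by omega) he e'
  have hb2 : ∀ e < d + 3, blockReg d (d + 1) e < blockReg d (d + 2) 0 := fun e he =>
    blockReg_lt_of_lt (by omega) he 0
  have hb3 : ∀ e < d + 3, blockReg d d e < blockReg d (d + 2) 0 := fun e he =>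
    blockReg_lt_of_lt (by omega) he 0
  have hbd := hb d 0
  have hbd1 := hb (d + 1) 0
  have hbd2 := hb (d + 1) d
  have hbd3 := hb (d + 2) 0
  refine Runs.seq ((Runs.loadRun (r := i) (by omega) (by omega) (by omega) (by omega) h7).weaken
    fun t ⟨ht, htx, htb⟩ => ?_)
  refine Runs.seq ((Runs.loadRun (r := j) (by omega) (by omega) (by omega) (by omega)
    (by rw [htx 8 (by omega) (by omega) (by omega), h8])).weaken fun u ⟨hu, hux, hub⟩ => ?_)
  refine Runs.seq ((Runs.loadRun (r := i) (by omega) (by omega) (by omega) (by omega)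
    (by rw [hux 7 (by omega) (by omega) (by omega), htx 7 (by omega) (by omega) (by omega),
      h7])).weaken fun v ⟨hv, hvx, hvb⟩ => ?_)
  refine Runs.seq ((hc v).weaken fun w ⟨hw, hwx, hwb⟩ => ?_)
  have hA : ∀ e < d, v.reg (blockReg d d e) = s.bank 0 (i * d + e) := by
    intro e he
    have h1 := hb d e
    have h2 := hb1 e (by omega) 0
    have h3 := hb1 e (by omega) d
    rw [hvx _ (by omega) (by omega) (by omega), hux _ (by omega) (by omega) (by omega),
      ← blockReg_add, ht e he]
  have hp : ∀ e < d, v.reg (blockReg d (d + 1) e) = s.bank 2 (j * d + e) := by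
    intro e he
    have h1 := hb (d + 1) e
    rw [hvx _ (by omega) (by omega) (by unfold blockReg; omega), ← blockReg_add, hu e he, htb]
  have hβ : v.reg (blockReg d (d + 1) d) = s.bank 1 i := by
    simpa [hub, htb] using hv 0 (by omega)
  have hsmall : ∀ y < 20, y ≠ 5 → y ≠ 6 → w.reg y = s.reg y := by
    intro y hy h5 h6
    rw [hwx y (by omega), hvx y h5 h6 (by omega), hux y h5 h6 (by omega), htx y h5 h6 (by omega)]
  have hbank : w.bank = s.bank := by rw [hwb, hvb, hub, htb]
  have hdd := hb d d
  refine Runs.seq (Runs.copy ?_)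
  refine (Runs.pushRows (l := l) (q := q) (α := s.bank 0) (β := s.bank 1) (π := s.bank 2)
    (x := j * l + i) ?_ ?_ ?_).weaken fun z ⟨hzf, hzb, hzx⟩ => ⟨hzf, ?_, ?_⟩
  · rw [State.setReg_reg, if_neg (by omega), hsmall 4 (by omega) (by omega) (by omega), h4]
  · refine hs.of_eq ?_ (by rw [State.setReg_bank, hbank])
    rw [State.setReg_reg, if_neg (by omega), hsmall 3 (by omega) (by omega) (by omega)]
  · intro e he
    rw [hyperplaneRow, if_pos (mul_add_lt_mul hj hi), mul_add_mod_of_lt hi, mul_add_div_of_lt hi,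
      State.setReg_reg]
    rcases he.lt_or_eq with he | rfl
    · rw [if_neg (by unfold blockReg; omega), if_pos he, hwx _ (hb3 e (by omega)), hA e he]
    · rw [if_pos rfl, if_neg (lt_irrefl _), hw, hβ]
      congr 1
      refine Finset.sum_congr rfl fun e' he' => ?_
      rw [hA e' (Finset.mem_range.1 he'), hp e' (Finset.mem_range.1 he')]
  · intro a ha
    rw [hzb a ha, State.setReg_bank, hbank]
  · intro y hy h3 h5 h6
    have := hb d (d + 1)
    rw [hzx y h3 h5 h6 (by omega), State.setReg_reg, if_neg (by omega), hsmall y hy h5 h6]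

/-- Block `d` := the `k`-th unit vector, with `n` entries. -/
def Program.unitRow (d k : ℕ) : ℕ → Program
  | 0 => .skip
  | n + 1 => .seq (unitRow d k n) (.const (blockReg d d n) (if n = k then 1 else 0))

lemma Runs.unitRow (d k n : ℕ) (s : State) : Runs (.unitRow d k n) s n fun t =>
    (∀ e < n, t.reg (blockReg d d e) = if e = k then 1 else 0) ∧ t.bank = s.bank ∧
    ∀ y < 20, t.reg y = s.reg y := by
  induction n with
  | zero => exact Runs.skip ⟨by simp, rfl, by simp⟩
  | succ n ih =>
    refine Runs.seq (ih.weaken fun t ⟨ht, htb, hty⟩ => Runs.const ⟨?_, by simp [htb], ?_⟩)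
    · intro e he
      rcases (show e < n ∨ e = n by omega) with h | rfl
      · rw [State.setReg_reg, if_neg (by unfold blockReg; omega), ht e h]
      · rw [State.setReg_reg, if_pos rfl]
        split_ifs <;> simp
    · intro y hy
      have := le_blockReg d d n
      rw [State.setReg_reg, if_neg (by omega), hty y hy]

/-- Append the rows of the first `n` coordinate hyperplanes. -/
def Program.pushCoordinates (d : ℕ) : ℕ → Program
  | 0 => .skip
  | n + 1 => .seq (pushCoordinates d n) (.seq (.unitRow d n (d + 1)) (.pushRows d))

lemma Runs.pushCoordinates (n : ℕ) {s : State} (h4 : s.reg 4 = 1)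
    (hs : Filled d (signedRow l q d α β π) (3 * (q * l)) s) :
    Runs (.pushCoordinates d n) s (n * (d + 1 + 3 * ((d + 2) * 5 + 2))) fun t =>
      Filled d (signedRow l q d α β π) (3 * (q * l + n)) t ∧
      ∀ y < 20, y ≠ 3 → y ≠ 5 → y ≠ 6 → t.reg y = s.reg y := by
  induction n with
  | zero => exact (Runs.skip ⟨hs, by simp⟩).mono (by omega) fun _ h => h
  | succ n ih =>
    rw [add_mul, one_mul]
    refine Runs.seq (ih.weaken fun t ⟨htf, hty⟩ => Runs.seq ((Runs.unitRow d n (d + 1) t).weaken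
      fun u ⟨hu, hub, huy⟩ => ?_))
    refine (Runs.pushRows (l := l) (q := q) (α := α) (β := β) (π := π) (x := q * l + n) ?_
      (htf.of_eq (huy 3 (by omega)) (by rw [hub])) ?_).weaken fun v ⟨hvf, _, hvy⟩ => ⟨hvf, ?_⟩
    · rw [huy 4 (by omega), hty 4 (by omega) (by omega) (by omega) (by omega), h4]
    · intro e he
      rw [hu e (by omega), hyperplaneRow, if_neg (show ¬ q * l + n < q * l by omega), Nat.add_sub_cancel_left]
    · intro y hy h3 h5 h6
      have := le_blockReg d d (d + 1)
      rw [hvy y h3 h5 h6 (by omega), huy y hy, hty y hy h3 h5 h6]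

/-- Write the table of all hyperplanes. -/
def Program.fillTable (d : ℕ) (c : Program) : Program :=
  .seq (.const 4 1) (.seq (.count 8 1 (.count 7 0 (.pushHyperplane d c))) (.pushCoordinates d d))

lemma exists_runs_fillTable (d : ℕ) : ∃ (c : Program) (C : ℕ), ∀ (l q : ℕ) (s : State),
    s.reg 0 = l → s.reg 1 = q → s.reg 3 = 0 →
    Runs (.fillTable d c) s (C * (max l 1 * max q 1)) fun t =>
      Filled d (signedRow l q d (s.bank 0) (s.bank 1) (s.bank 2)) (3 * (q * l + d)) t ∧
      t.reg 0 = l ∧ t.reg 1 = q ∧ t.reg 2 = s.reg 2 ∧ t.reg 4 = 1 := by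
  obtain ⟨c, K, hc⟩ := exists_runs_pushHyperplane d
  -- Per pair `(i, j)` the cost is `K + 2`, per point `4`, and `3` once, besides the coordinate
  -- hyperplanes.
  refine ⟨c, K + 9 + d * (d + 1 + 3 * ((d + 2) * 5 + 2)), fun l q s h0 h1 h3 => ?_⟩
  set f := signedRow l q d (s.bank 0) (s.bank 1) (s.bank 2) with hf
  let Inv : ℕ → State → Prop := fun j t => Filled d f (3 * (j * l)) t ∧
    (∀ a, a ≠ 4 → t.bank a = s.bank a) ∧ t.reg 0 = l ∧ t.reg 2 = s.reg 2
  let Inv' : ℕ → ℕ → State → Prop := fun j i t => Filled d f (3 * (j * l + i)) t ∧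
    (∀ a, a ≠ 4 → t.bank a = s.bank a) ∧ t.reg 1 = q ∧ t.reg 2 = s.reg 2 ∧ t.reg 8 = j
  have hinner : ∀ j < q, ∀ t, Inv j t → t.reg 8 = j → t.reg 1 = q → t.reg 4 = 1 →
      Runs (.count 7 0 (.pushHyperplane d c)) t (l * (K + 2) + 2) fun u =>
        Inv (j + 1) u ∧ u.reg 8 = j ∧ u.reg 1 = q ∧ u.reg 4 = 1 := by
    intro j hj t hI h8 h1 h4
    refine (Runs.count (n := l) (by omega) (by omega) (Inv' j) ?_ ?_
      ⟨hI.1, hI.2.1, h1, hI.2.2.2, h8⟩ hI.2.2.1 h4).weaken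
      fun u ⟨⟨hu1, hu2, hu3, hu4, hu5⟩, hu6, hu7⟩ => ⟨⟨?_, hu2, hu6, hu4⟩, hu5, hu3, hu7⟩
    · rintro i t v ⟨h1, h2, h3, h4, h5⟩
      exact ⟨h1.of_eq (by simp) (by simp), by simpa using h2, by simp [h3], by simp [h4],
        by simp [h5]⟩
    · rintro i hi t ⟨ht1, ht2, ht3, ht4, ht5⟩ h7 h0 h4
      have hrun := hc l q i j t hi hj h4 h7 ht5
      rw [ht2 0 (by omega), ht2 1 (by omega), ht2 2 (by omega)] at hrun
      refine (hrun ht1).weaken fun u ⟨hu1, hu2, hu3⟩ => ?_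
      have hsame : ∀ y < 20, y ≠ 3 → y ≠ 5 → y ≠ 6 → u.reg y = t.reg y := hu3
      refine ⟨⟨hu1, fun a ha => ?_, ?_, ?_, ?_⟩, ?_, ?_, ?_⟩
      · rw [hu2 a ha, ht2 a ha]
      all_goals rw [hsame _ (by omega) (by omega) (by omega) (by omega)]; assumption
    · rw [show (j + 1) * l = j * l + l by ring]
      exact hu1
  have hinit : Inv 0 (s.setReg 4 1) := by
    refine ⟨⟨by simp [h3], fun r hr => by omega⟩, fun a _ => rfl, by simp [h0], by simp⟩
  have hrun := Runs.count (n := q) (s := s.setReg 4 1) (by omega) (by omega) Inv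
    (by
      rintro i t v ⟨h1, h2, h3, h4⟩
      exact ⟨h1.of_eq (by simp) (by simp), by simpa using h2, by simp [h3], by simp [h4]⟩)
    hinner hinit (by simp [h1]) (by simp)
  refine (Runs.seq (c₁ := .const 4 1) (K₁ := 1)
    (K₂ := (q * (l * (K + 2) + 2 + 2) + 2) + d * (d + 1 + 3 * ((d + 2) * 5 + 2)))
    (Runs.const ?_)).mono (Q := fun t => Filled d f (3 * (q * l + d)) t ∧
      t.reg 0 = l ∧ t.reg 1 = q ∧ t.reg 2 = s.reg 2 ∧ t.reg 4 = 1) ?_ fun _ h => h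
  · rw [Int.cast_one]
    refine Runs.seq (hrun.weaken fun t ⟨⟨ht1, ht2, ht3, ht4⟩, ht5, ht6⟩ => ?_)
    refine (Runs.pushCoordinates d ht6 ht1).weaken fun u ⟨hu1, hu2⟩ => ⟨hu1, ?_, ?_, ?_, ?_⟩
    all_goals rw [hu2 _ (by omega) (by omega) (by omega) (by omega)]; assumption
  · set D := d * (d + 1 + 3 * ((d + 2) * 5 + 2))
    have h1 : 1 ≤ max l 1 * max q 1 := Nat.mul_pos (by omega) (by omega)
    have h2 : q * l ≤ max l 1 * max q 1 := by
      rw [mul_comm]; exact Nat.mul_le_mul (le_max_left _ _) (le_max_left _ _)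
    have h3 : q ≤ max l 1 * max q 1 :=
      (le_max_left q 1).trans (Nat.le_mul_of_pos_left _ (by omega))
    nlinarith [Nat.mul_le_mul_right (K + 2) h2, Nat.mul_le_mul_right D h1]

end Fill

end RealRAM

namespace RealRAM

/-! ### Enumerating tuples and listing the selected sets. -/

section Enumerate

/-- The state displays the family `F` of subsets of `{0, …, q - 1}`, with register `2` holding the
length of the list. -/
def Lists (q : ℕ) (F : Set (Set ℕ)) (s : State) : Prop :=
  ∃ m : ℕ, s.reg 2 = m ∧
    (∀ r < m, ∀ j < q, s.bank 3 (r * q + j) = 0 ∨ s.bank 3 (r * q + j) = 1) ∧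
    F = {B | ∃ r < m, B = {j | j < q ∧ s.bank 3 (r * q + j) = 1}}

lemma Lists.of_eq {q : ℕ} {F : Set (Set ℕ)} {s t : State} (h : Lists q F s)
    (hr : t.reg 2 = s.reg 2) (hb : t.bank 3 = s.bank 3) : Lists q F t := by
  rw [Lists, hr, hb]
  exact h

lemma Lists.append {q m : ℕ} {F : Set (Set ℕ)} {s t : State} (h : Lists q F s)
    (hm : s.reg 2 = m) (ht : t.reg 2 = m + 1)
    (hold : ∀ y < m * q, t.bank 3 y = s.bank 3 y) (B : Set ℕ) [DecidablePred (· ∈ B)]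
    (hB : ∀ j < q, t.bank 3 (m * q + j) = if j ∈ B then 1 else 0) :
    Lists q (F ∪ {{j | j < q ∧ j ∈ B}}) t := by
  obtain ⟨m', hm', hbits, hF⟩ := h
  obtain rfl : m' = m := by
    rw [hm] at hm'
    exact_mod_cast hm'.symm
  have hlt : ∀ r < m', ∀ j < q, t.bank 3 (r * q + j) = s.bank 3 (r * q + j) := fun r hr j hj =>
    hold _ (mul_add_lt_mul hr hj)
  have hset : ∀ r < m', {j | j < q ∧ t.bank 3 (r * q + j) = 1} =
      {j | j < q ∧ s.bank 3 (r * q + j) = 1} := by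
    intro r hr
    ext j
    exact and_congr_right fun hj => by rw [hlt r hr j hj]
  have hnew : {j | j < q ∧ t.bank 3 (m' * q + j) = 1} = {j | j < q ∧ j ∈ B} := by
    ext j
    refine and_congr_right fun hj => ?_
    rw [hB j hj]
    simp
  refine ⟨m' + 1, by rw [ht]; push_cast; rfl, ?_, ?_⟩
  · intro r hr j hj
    rcases (show r < m' ∨ r = m' by omega) with h | rfl
    · rw [hlt r h j hj]
      exact hbits r h j hj
    · rw [hB j hj]
      split_ifs <;> simp
  · rw [hF]
    ext C
    constructor
    · rintro (⟨r, hr, rfl⟩ | rfl)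
      · exact ⟨r, by omega, (hset r hr).symm⟩
      · exact ⟨m', by omega, hnew.symm⟩
    · rintro ⟨r, hr, rfl⟩
      rcases (show r < m' ∨ r = m' by omega) with h | rfl
      · exact Or.inl ⟨r, h, hset r h⟩
      · exact Or.inr hnew

lemma rowCoeff_congr {d : ℕ} {X Y : ℕ → ℕ → ℝ} (h : ∀ k ≤ d, ∀ e < d + 2, X k e = Y k e) :
    rowCoeff d X = rowCoeff d Y := by
  have h1 : normalMatrix d X = normalMatrix d Y := by
    funext k e
    exact h k k.2.le e (by omega)
  have h2 : (fun k : Fin d => X k d) = fun k : Fin d => Y k d :=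
    funext fun k => h k k.2.le d (by omega)
  have h3 : (fun k : Fin d => X k (d + 1)) = fun k : Fin d => Y k (d + 1) :=
    funext fun k => h k k.2.le (d + 1) (by omega)
  have h4 : (fun e : Fin d => X d e) = fun e : Fin d => Y d e :=
    funext fun e => h d le_rfl e (by omega)
  rw [rowCoeff, h1, h2, h3, h4, h d le_rfl d (by omega), rowCoeff]

open Classical in
-- The unit-cost test: `K` depends on `d` only. The result goes to block `d + 2`, beyond all rows it
-- reads.
lemma exists_program_lexPos (d : ℕ) : ∃ (c : Program) (K : ℕ), ∀ s : State, Runs c s K fun t =>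
    t.reg (blockReg d (d + 2) 0) = (if LexPos (List.ofFn (rowCoeff d fun k e =>
      s.reg (blockReg d k e))) then 1 else 0) ∧
    (∀ x < blockReg d (d + 2) 0, t.reg x = s.reg x) ∧ t.bank = s.bank := by
  have hreg : ∀ k ≤ d, ∀ e < d + 2, Realizable (blockReg d (d + 2) 0) fun ρ =>
      ρ (blockReg d k e) := fun k hk e he =>
    .reg (blockReg_lt_of_lt (by omega) (by omega) _)
  have hcoeff : ∀ i, Realizable (blockReg d (d + 2) 0) fun ρ =>
      rowCoeff d (fun k e => ρ (blockReg d k e)) i := fun i =>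
    Realizable.cellCoeff (fun k e => hreg k k.2.le e (by omega))
      (fun k => hreg k k.2.le d (by omega)) (fun k => hreg k k.2.le (d + 1) (by omega))
      (fun e => hreg d le_rfl e (by omega)) (hreg d le_rfl d (by omega)) i
  have h := Realizable.lexPos (V := blockReg d (d + 2) 0) (List.ofFn fun i ρ =>
    rowCoeff d (fun k e => ρ (blockReg d k e)) i) (by
      intro f hf
      obtain ⟨i, rfl⟩ := (List.mem_ofFn' _ _).1 hf
      exact hcoeff i)
  simpa only [List.map_ofFn, Function.comp_def] using h.exists_program _ le_rfl

lemma exists_program_det (d : ℕ) : ∃ (c : Program) (K : ℕ), ∀ s : State, Runs c s K fun t =>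
    t.reg (blockReg d (d + 2) 0) = (normalMatrix d fun k e => s.reg (blockReg d k e)).det ∧
    (∀ x < blockReg d (d + 2) 0, t.reg x = s.reg x) ∧ t.bank = s.bank := by
  have h : Realizable (blockReg d (d + 2) 0) fun ρ =>
      (normalMatrix d fun k e => ρ (blockReg d k e)).det :=
    Realizable.det fun k e => .reg (blockReg_lt_of_lt (by omega) (by omega) _)
  exact h.exists_program _ le_rfl

/-- Load the row whose number is in block `k` into that block. -/
def Program.loadRow (d k : ℕ) : Program :=
  .loadRun 4 (blockReg d k (d + 2)) (d + 2) (blockReg d k 0) (d + 2)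

lemma Runs.loadRow {d k r R : ℕ} {f : ℕ → ℕ → ℝ} {s : State} (hs : Filled d f R s) (hr : r < R)
    (hk : s.reg (blockReg d k (d + 2)) = r) :
    Runs (.loadRow d k) s ((d + 2) * 5) fun t =>
      (∀ e < d + 2, t.reg (blockReg d k e) = f r e) ∧
      (∀ x, x ≠ 5 → x ≠ 6 → (x < blockReg d k 0 ∨ blockReg d k (d + 2) ≤ x) →
        t.reg x = s.reg x) ∧ t.bank = s.bank := by
  have h := le_blockReg d k
  refine (Runs.loadRun (r := r) (by have := h 0; omega) (by have := h (d + 2); omega)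
    (by have := h (d + 2); omega) (by unfold blockReg; omega) hk).weaken
    fun t ⟨ht, htx, htb⟩ => ⟨fun e he => ?_, htx, htb⟩
  rw [← hs.2 r hr e he, ← ht e he, blockReg_add]

/-- Reset register `9` unless the current row passes the test `c`, and go to the next hyperplane. -/
def Program.testRow (d : ℕ) (c : Program) : Program :=
  .seq (.loadRow d d) (.seq c (.seq (.const 5 0) (.seq
    (.ite (.eq (blockReg d (d + 2) 0) 5) (.const 9 0) (.copy 9 9))
    (.seq (.const 5 3) (.arith .add (blockReg d d (d + 2)) (blockReg d d (d + 2)) 5)))))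

open Classical in
-- Register `9` accumulates a conjunction. The row number advances by `3` because one signed copy
-- per hyperplane is tested.
lemma exists_runs_testRow (d : ℕ) : ∃ (c : Program) (K : ℕ), ∀ (f : ℕ → ℕ → ℝ) (w : ℕ → ℕ)
    (R r : ℕ) (s : State), Filled d f R s → r < R → s.reg (blockReg d d (d + 2)) = r →
    (∀ k < d, ∀ e < d + 2, s.reg (blockReg d k e) = f (w k) e) →
    Runs (.testRow d c) s K fun t =>
      t.reg 9 = (if LexPos (List.ofFn (rowCoeff d fun k => f (if k < d then w k else r)))
        then s.reg 9 else 0) ∧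
      t.reg (blockReg d d (d + 2)) = (r + 3 : ℕ) ∧
      (∀ x < blockReg d d 0, x ≠ 5 → x ≠ 6 → x ≠ 9 → t.reg x = s.reg x) ∧ t.bank = s.bank := by
  obtain ⟨c, K, hc⟩ := exists_program_lexPos d
  refine ⟨c, (d + 2) * 5 + (K + (1 + (2 + (1 + 1)))), fun f w R r s hs hr hg hw => ?_⟩
  have hV := le_blockReg d (d + 2) 0
  have hg20 := le_blockReg d d (d + 2)
  have hd20 := le_blockReg d d 0
  have hgV : blockReg d d (d + 2) < blockReg d (d + 2) 0 :=
    blockReg_lt_of_lt (by omega) (by omega) _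
  have hdV : blockReg d d 0 < blockReg d (d + 2) 0 := blockReg_lt_of_lt (by omega) (by omega) _
  have hdg : blockReg d d 0 < blockReg d d (d + 2) := by unfold blockReg; omega
  refine Runs.seq ((Runs.loadRow hs hr hg).weaken fun t ⟨ht, htx, htb⟩ => Runs.seq ((hc t).weaken
    fun u ⟨hu, hux, hub⟩ => ?_))
  have hcoeff : (rowCoeff d fun k e => t.reg (blockReg d k e)) =
      rowCoeff d fun k => f (if k < d then w k else r) := by
    refine rowCoeff_congr fun k hk e he => ?_
    rcases hk.lt_or_eq with hk | rfl
    · have h1 := le_blockReg d k e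
      rw [if_pos hk, htx _ (by omega) (by omega)
        (Or.inl (blockReg_lt_of_lt hk (by omega) _)), hw k hk e he]
    · rw [if_neg (lt_irrefl _), ht e he]
  rw [hcoeff] at hu
  have hsmall : ∀ x < blockReg d d 0, x ≠ 5 → x ≠ 6 → u.reg x = s.reg x := fun x hx h5 h6 => by
    rw [hux x (by omega), htx x h5 h6 (Or.inl hx)]
  have hug : u.reg (blockReg d d (d + 2)) = r := by
    rw [hux _ hgV, htx _ (by omega) (by omega) (Or.inr le_rfl), hg]
  have hbank : u.bank = s.bank := by rw [hub, htb]
  refine Runs.seq (Runs.const (Runs.seq (Q := _) (Runs.weaken (Q := fun v =>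
    v.reg 9 = (if LexPos (List.ofFn (rowCoeff d fun k => f (if k < d then w k else r)))
      then s.reg 9 else 0) ∧ (∀ x, x ≠ 5 → x ≠ 9 → v.reg x = u.reg x) ∧ v.bank = s.bank)
    (Runs.ite (fun h => Runs.const ?_) fun h => Runs.copy ?_) fun v ⟨hv, hvx, hvb⟩ =>
      Runs.seq (Runs.const (Runs.add ?_)))))
  · have h0 : ¬ LexPos (List.ofFn (rowCoeff d fun k => f (if k < d then w k else r))) := by
      intro h1
      simp [-List.ofFn_succ, Test.Holds, (show blockReg d (d + 2) 0 ≠ 5 by omega), hu, h1] at h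
    refine ⟨by simp [-List.ofFn_succ, h0], fun x h5 h9 => by simp [h5, h9], by simp [hbank]⟩
  · have h0 : LexPos (List.ofFn (rowCoeff d fun k => f (if k < d then w k else r))) := by
      by_contra h1
      simp [-List.ofFn_succ, Test.Holds, (show blockReg d (d + 2) 0 ≠ 5 by omega), hu, h1] at h
    refine ⟨?_, fun x h5 h9 => by simp [h5, h9], by simp [hbank]⟩
    simp [-List.ofFn_succ, h0, hsmall 9 (by omega) (by omega) (by omega)]
  · refine ⟨?_, ?_, ?_, by simp [hvb]⟩
    · simp [(show 9 ≠ blockReg d d (d + 2) by omega), hv]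
    · simp [(show blockReg d d (d + 2) ≠ 5 by omega), hvx _ (show blockReg d d (d + 2) ≠ 5 by omega)
        (show blockReg d d (d + 2) ≠ 9 by omega), hug]
    · intro x hx h5 h6 h9
      rw [State.setReg_reg, if_neg (by omega), State.setReg_reg, if_neg h5, hvx x h5 h9,
        hsmall x hx h5 h6]

/-- Write the incidence bit of point `reg 8` of the current subset. -/
def Program.testPoint (d : ℕ) (c : Program) : Program :=
  .seq (.const 9 1) (.seq (.count 7 0 (.testRow d c)) (.seq (.arith .mul 5 2 1)
    (.seq (.arith .add 5 5 8) (.store 3 5 9))))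

open Classical in
-- The table is ordered point by point, so the row number is not reset: after point `j` it already
-- addresses the first hyperplane of point `j + 1`.
lemma exists_runs_testPoint (d : ℕ) : ∃ (c : Program) (K : ℕ), ∀ (f : ℕ → ℕ → ℝ) (w : ℕ → ℕ)
    (R l q m j : ℕ) (s : State), Filled d f R s → 3 * (q * l) ≤ R → j < q →
    s.reg 0 = l → s.reg 1 = q → s.reg 2 = m → s.reg 4 = 1 → s.reg 8 = j →
    s.reg (blockReg d d (d + 2)) = (3 * (j * l) : ℕ) →
    (∀ k < d, ∀ e < d + 2, s.reg (blockReg d k e) = f (w k) e) →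
    Runs (.testPoint d c) s (l * (K + 2) + 6) fun t =>
      t.bank 3 (m * q + j) = (if SelectsPoint l d f w j then 1 else 0) ∧
      (∀ y < m * q + j, t.bank 3 y = s.bank 3 y) ∧ (∀ a, a ≠ 3 → t.bank a = s.bank a) ∧
      t.reg (blockReg d d (d + 2)) = (3 * ((j + 1) * l) : ℕ) ∧
      (∀ x < blockReg d d 0, x ≠ 5 → x ≠ 6 → x ≠ 7 → x ≠ 9 → t.reg x = s.reg x) := by
  obtain ⟨c, K, hc⟩ := exists_runs_testRow d
  refine ⟨c, K, fun f w R l q m j s hs hR hj h0 h1 h2 h4 h8 hg hw => ?_⟩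
  have hg20 := le_blockReg d d (d + 2)
  have hd20 := le_blockReg d d 0
  have hdg : blockReg d d 0 < blockReg d d (d + 2) := by unfold blockReg; omega
  let P : ℕ → Prop := fun i => LexPos (List.ofFn (rowCoeff d fun k =>
    f (if k < d then w k else 3 * (j * l + i))))
  let Inv : ℕ → State → Prop := fun i t =>
    (∀ x < blockReg d d 0, x ≠ 5 → x ≠ 6 → x ≠ 7 → x ≠ 9 → t.reg x = s.reg x) ∧
    t.bank = s.bank ∧ t.reg (blockReg d d (d + 2)) = (3 * (j * l + i) : ℕ) ∧
    t.reg 9 = if ∀ i' < i, P i' then 1 else 0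
  have hloop := Runs.count (n := l) (x := 7) (y := 0) (s := s.setReg 9 1) (c := .testRow d c) (K := K)
    (by omega) (by omega) Inv ?_ ?_ ?_ (by simp [h0]) (by simp [h4])
  · have e1 : l * (K + 2) + 6 = 1 + ((l * (K + 2) + 2) + (1 + (1 + 1))) := by omega
    rw [e1]
    refine Runs.seq (Runs.const ?_)
    rw [Int.cast_one]
    refine Runs.seq (hloop.weaken fun t ⟨⟨htx, htb, htg, ht9⟩, ht0, ht4⟩ => ?_)
    have ht1 := htx 1 (by omega) (by omega) (by omega) (by omega) (by omega)
    have ht2 := htx 2 (by omega) (by omega) (by omega) (by omega) (by omega)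
    have ht8 := htx 8 (by omega) (by omega) (by omega) (by omega) (by omega)
    refine Runs.seq (Runs.mul (Runs.seq (Runs.add (Runs.store (i := m * q + j) ?_
      ⟨?_, ?_, ?_, ?_, ?_⟩))))
    · simp [ht1, ht2, ht8, h1, h2, h8]
    · simp only [State.setBank_bank, true_and, if_true]
      simp [ht9, SelectsPoint, P]
    · intro y hy
      rw [State.setBank_bank, if_neg (by omega)]
      simp [htb]
    · intro a ha
      rw [State.setBank_bank_of_ne _ _ _ ha]
      simp [htb]
    · rw [add_mul, one_mul]
      simp only [State.setBank_reg]
      rw [State.setReg_reg, if_neg (by omega), State.setReg_reg, if_neg (by omega), htg]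
    · intro x hx h5 h6 h7 h9
      simp [h5, htx x hx h5 h6 h7 h9]
  · rintro i t v ⟨ht1, ht2, ht3, ht4⟩
    refine ⟨fun x hx h5 h6 h7 h9 => ?_, by simpa using ht2, ?_, ?_⟩
    · rw [State.setReg_reg, if_neg h7, ht1 x hx h5 h6 h7 h9]
    · rw [State.setReg_reg, if_neg (by omega), ht3]
    · rw [State.setReg_reg, if_neg (by omega), ht4]
  · rintro i hi t ⟨ht1, ht2, ht3, ht4⟩ h7t h0t h4t
    have hlt := mul_add_lt_mul hj hi
    refine (hc f w R (3 * (j * l + i)) t (hs.of_eq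
      (ht1 3 (by omega) (by omega) (by omega) (by omega) (by omega)) (by rw [ht2])) (by omega) ht3
      fun k hk e he => ?_).weaken fun u ⟨hu9, hug, hux, hub⟩ => ⟨⟨?_, ?_, ?_, ?_⟩, ?_, ?_, ?_⟩
    · have h20 := le_blockReg d k e
      rw [ht1 _ (blockReg_lt_of_lt hk (by omega) _) (by omega) (by omega) (by omega) (by omega),
        hw k hk e he]
    · intro x hx h5 h6 h7 h9
      rw [hux x hx h5 h6 h9, ht1 x hx h5 h6 h7 h9]
    · rw [hub, ht2]
    · rw [hug]
      congr 1
    · rw [hu9, ht4]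
      show (if P i then _ else _) = _
      by_cases hall : ∀ i' < i, P i'
      · by_cases hPi : P i
        · rw [if_pos hPi, if_pos hall, if_pos]
          intro i' hi'
          rcases (show i' < i ∨ i' = i by omega) with h | rfl
          · exact hall i' h
          · exact hPi
        · rw [if_neg hPi, if_neg fun h => hPi (h i (by omega))]
      · rw [if_neg hall, if_neg (show ¬ ∀ i' < i + 1, P i' from
          fun h => hall fun i' hi' => h i' (by omega))]
        simp
    all_goals rw [hux _ (by omega) (by omega) (by omega) (by omega)]; assumption
  · refine ⟨fun x hx h5 h6 h7 h9 => by simp [h9], rfl, ?_, by simp⟩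
    rw [State.setReg_reg, if_neg (by omega), hg, add_zero]

/-- Append the subset given by blocks `0, …, d - 1` to the list, if these determine a point. -/
def Program.emit (d : ℕ) (cdet ctest : Program) : Program :=
  .seq cdet (.seq (.const 5 0) (.ite (.eq (blockReg d (d + 2) 0) 5) .skip
    (.seq (.const (blockReg d d (d + 2)) 0) (.seq (.count 8 1 (.testPoint d ctest))
      (.arith .add 2 2 4)))))

/-- The subsets listed for the tuples which extend `w k, …, w (d - 1)`. -/
def listedFamily (l q d R : ℕ) (f : ℕ → ℕ → ℝ) (k : ℕ) (w : ℕ → ℕ) : Set (Set ℕ) :=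
  {B | ∃ v : ℕ → ℕ, (∀ i < k, v i < R) ∧ (∀ i, k ≤ i → v i = w i) ∧
    (normalMatrix d fun i => f (v i)).det ≠ 0 ∧ B = {j | j < q ∧ SelectsPoint l d f v j}}

/-- With all rows fixed, `listedFamily` is empty or a singleton, according to the determinant; the
cost is one bounded test for each pair `(i, j)`, plus overhead linear in `q`. -/
lemma exists_runs_emit (d : ℕ) : ∃ (cdet ctest : Program) (C : ℕ), ∀ (f : ℕ → ℕ → ℝ) (w : ℕ → ℕ)
    (R l q : ℕ) (F : Set (Set ℕ)) (s : State), Filled d f R s → 3 * (q * l) ≤ R →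
    s.reg 0 = l → s.reg 1 = q → s.reg 4 = 1 →
    (∀ k < d, ∀ e < d + 2, s.reg (blockReg d k e) = f (w k) e) → Lists q F s →
    Runs (.emit d cdet ctest) s (C * (max l 1 * max q 1)) fun t =>
      Lists q (F ∪ listedFamily l q d R f 0 w) t ∧ t.bank 4 = s.bank 4 ∧
      (∀ x < blockReg d d 0, x ≠ 2 → (x < 5 ∨ 20 ≤ x) → t.reg x = s.reg x) := by
  classical
  obtain ⟨cdet, K₁, h₁⟩ := exists_program_det d
  obtain ⟨ctest, K₂, h₂⟩ := exists_runs_testPoint d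
  refine ⟨cdet, ctest, K₁ + K₂ + 17, fun f w R l q F s hs hR h0 h1 h4 hw hF => ?_⟩
  have hV := le_blockReg d (d + 2) 0
  have hg20 := le_blockReg d d (d + 2)
  have hd20 := le_blockReg d d 0
  have hdg : blockReg d d 0 < blockReg d d (d + 2) := by unfold blockReg; omega
  have hdV : blockReg d d 0 < blockReg d (d + 2) 0 := blockReg_lt_of_lt (by omega) (by omega) _
  obtain ⟨m, hm, -⟩ := id hF
  refine (Runs.seq (K₁ := K₁) (K₂ := 1 + ((1 + ((q * (l * (K₂ + 2) + 6 + 2) + 2) + 1)) + 1))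
    ((h₁ s).weaken fun t ⟨ht, htx, htb⟩ => Runs.seq (Runs.const (Runs.ite
      (fun h => Runs.mono (Runs.skip ?_) (Nat.zero_le _) fun _ h => h)
      fun h => Runs.seq (Runs.const ?_))))).mono (Q := fun t =>
      Lists q (F ∪ listedFamily l q d R f 0 w) t ∧ t.bank 4 = s.bank 4 ∧
      (∀ x < blockReg d d 0, x ≠ 2 → (x < 5 ∨ 20 ≤ x) → t.reg x = s.reg x)) ?_ fun _ h => h
  · have hdet : (normalMatrix d fun i => f (w i)).det = 0 := by
      have : (normalMatrix d fun k e => s.reg (blockReg d k e)) =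
          normalMatrix d fun i => f (w i) := by
        funext k e
        exact hw k k.2 e (by omega)
      rw [← this, ← ht]
      simpa [Test.Holds, (show blockReg d (d + 2) 0 ≠ 5 by omega)] using h
    have hempty : listedFamily l q d R f 0 w = ∅ := by
      rw [Set.eq_empty_iff_forall_notMem]
      rintro B ⟨v, -, hv, hv', -⟩
      rw [show v = w from funext fun i => hv i (by omega)] at hv'
      exact hv' hdet
    rw [hempty, Set.union_empty]
    refine ⟨hF.of_eq ?_ (by simp [htb]), by simp [htb], fun x hx hx2 hx5 => ?_⟩
    · simp [htx 2 (by omega)]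
    · rw [State.setReg_reg, if_neg (by omega), htx x (by omega)]
  · have hdet : (normalMatrix d fun i => f (w i)).det ≠ 0 := by
      have : (normalMatrix d fun k e => s.reg (blockReg d k e)) =
          normalMatrix d fun i => f (w i) := by
        funext k e
        exact hw k k.2 e (by omega)
      rw [← this, ← ht]
      simpa [Test.Holds, (show blockReg d (d + 2) 0 ≠ 5 by omega)] using h
    have hone : listedFamily l q d R f 0 w = {{j | j < q ∧ SelectsPoint l d f w j}} := by
      ext B
      constructor
      · rintro ⟨v, -, hv, hv', rfl⟩
        rw [show v = w from funext fun i => hv i (by omega)]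
        rfl
      · rintro rfl
        exact ⟨w, by simp, fun _ _ => rfl, hdet, rfl⟩
    rw [hone]
    let Inv : ℕ → State → Prop := fun j u =>
      (∀ x < blockReg d d 0, (x < 5 ∨ 20 ≤ x) → u.reg x = s.reg x) ∧
      u.bank 4 = s.bank 4 ∧ (∀ y < m * q, u.bank 3 y = s.bank 3 y) ∧
      (∀ j' < j, u.bank 3 (m * q + j') = if SelectsPoint l d f w j' then 1 else 0) ∧
      u.reg (blockReg d d (d + 2)) = (3 * (j * l) : ℕ)
    refine Runs.seq ((Runs.count (n := q) (K := l * (K₂ + 2) + 6) (by omega) (by omega) Inv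
      ?_ ?_ ?_ ?_ ?_).weaken fun u ⟨⟨hu1, hu2, hu3, hu4, hu5⟩, hu6, hu7⟩ => Runs.add ⟨?_, ?_, ?_⟩)
    · rintro j u v ⟨hu1, hu2, hu3, hu4, hu5⟩
      refine ⟨fun x hx hx' => ?_, by simpa using hu2, by simpa using hu3, by simpa using hu4, ?_⟩
      · rw [State.setReg_reg, if_neg (by omega), hu1 x hx hx']
      · rw [State.setReg_reg, if_neg (by omega), hu5]
    · rintro j hj u ⟨hu1, hu2, hu3, hu4, hu5⟩ h8u h1u h4u
      refine (h₂ f w R l q m j u (hs.of_eq (hu1 3 (by omega) (by omega)) hu2) hR hj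
        (by rw [hu1 0 (by omega) (by omega), h0]) h1u (by rw [hu1 2 (by omega) (by omega), hm])
        h4u h8u hu5 fun k hk e he => ?_).weaken
        fun v ⟨hv1, hv2, hv3, hv4, hv5⟩ => ⟨⟨?_, ?_, ?_, ?_, hv4⟩, ?_, ?_, ?_⟩
      · rw [hu1 _ (blockReg_lt_of_lt hk (by omega) _) (Or.inr (le_blockReg d k e)), hw k hk e he]
      · intro x hx hx'
        rw [hv5 x hx (by omega) (by omega) (by omega) (by omega), hu1 x hx hx']
      · rw [hv3 4 (by omega), hu2]
      · intro y hy
        rw [hv2 y (by omega), hu3 y hy]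
      · intro j' hj'
        rcases (show j' < j ∨ j' = j by omega) with h | rfl
        · rw [hv2 _ (by omega), hu4 j' h]
        · exact hv1
      all_goals rw [hv5 _ (by omega) (by omega) (by omega) (by omega) (by omega)]; assumption
    · refine ⟨fun x hx hx' => ?_, by simp [htb], by simp [htb], by simp, by simp⟩
      rw [State.setReg_reg, if_neg (by omega), State.setReg_reg, if_neg (by omega),
        htx x (by omega)]
    · rw [State.setReg_reg, if_neg (by omega), State.setReg_reg, if_neg (by omega),
        htx 1 (by omega), h1]
    · rw [State.setReg_reg, if_neg (by omega), State.setReg_reg, if_neg (by omega),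
        htx 4 (by omega), h4]
    · refine hF.append (m := m) hm ?_ (fun y hy => by simpa using hu3 y hy)
        {j | SelectsPoint l d f w j} fun j hj => by simpa using hu4 j hj
      simp [hu1 2 (by omega) (by omega), hu7, hm]
    · simpa using hu2
    · intro x hx hx2 hx'
      rw [State.setReg_reg, if_neg hx2, hu1 x hx hx']
  · have g1 : 1 ≤ max l 1 * max q 1 := Nat.mul_pos (by omega) (by omega)
    have g2 : q * l ≤ max l 1 * max q 1 := by
      rw [mul_comm]; exact Nat.mul_le_mul (le_max_left _ _) (le_max_left _ _)
    have g3 : q ≤ max l 1 * max q 1 :=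
      (le_max_left q 1).trans (Nat.le_mul_of_pos_left _ (by omega))
    nlinarith [Nat.mul_le_mul_right (K₂ + 2) g2, Nat.mul_le_mul_right K₁ g1]

/-- Loops over all choices of rows for blocks `0, …, k - 1`. -/
def Program.nest (d : ℕ) (c : Program) : ℕ → Program
  | 0 => c
  | k + 1 => .count (blockReg d k (d + 2)) 3 (.seq (.loadRow d k) (nest d c k))

/-- The set-theoretic counterpart of one loop of `Program.nest`. -/
lemma listedFamily_succ (l q d R : ℕ) (f : ℕ → ℕ → ℝ) (k : ℕ) (w : ℕ → ℕ) :
    listedFamily l q d R f (k + 1) w =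
      ⋃ r < R, listedFamily l q d R f k (Function.update w k r) := by
  ext B
  simp only [Set.mem_iUnion]
  constructor
  · rintro ⟨v, h1, h2, h3⟩
    refine ⟨v k, h1 k (by omega), v, fun i hi => h1 i (by omega), fun i hi => ?_, h3⟩
    rcases hi.eq_or_lt with rfl | hi
    · simp
    · rw [Function.update_of_ne hi.ne', h2 i hi]
  · rintro ⟨r, hr, v, h1, h2, h3⟩
    refine ⟨v, fun i hi => ?_, fun i hi => ?_, h3⟩
    · rcases (show i < k ∨ i = k by omega) with h | rfl
      · exact h1 i h
      · simpa [h2 i le_rfl] using hr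
    · rw [h2 i (by omega), Function.update_of_ne (by omega)]

/-- Every loop multiplies the cost by a constant times `max l 1 * max q 1`. The family `F` is
arbitrary because each round appends to earlier output, and the last clause protects the rows and
counters of the outer loops. -/
lemma exists_runs_nest (d : ℕ) : ∃ cdet ctest : Program, ∀ k ≤ d, ∃ C : ℕ,
    ∀ (f : ℕ → ℕ → ℝ) (w : ℕ → ℕ) (l q : ℕ) (F : Set (Set ℕ)) (s : State),
    Filled d f (3 * (q * l + d)) s → s.reg 0 = l → s.reg 1 = q → s.reg 4 = 1 →
    (∀ i, k ≤ i → i < d → ∀ e < d + 2, s.reg (blockReg d i e) = f (w i) e) → Lists q F s →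
    Runs (.nest d (.emit d cdet ctest) k) s (C * (max l 1 * max q 1) ^ (k + 1)) fun t =>
      Lists q (F ∪ listedFamily l q d (3 * (q * l + d)) f k w) t ∧ t.bank 4 = s.bank 4 ∧
      (∀ x < 5, x ≠ 2 → t.reg x = s.reg x) ∧
      (∀ x < blockReg d d 0, blockReg d k 0 ≤ x → t.reg x = s.reg x) := by
  obtain ⟨cdet, ctest, C₀, h₀⟩ := exists_runs_emit d
  refine ⟨cdet, ctest, fun k => ?_⟩
  have hd20 := le_blockReg d d 0
  induction k with
  | zero =>
    refine fun _ => ⟨C₀, fun f w l q F s hs h0 h1 h4 hw hF => ?_⟩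
    rw [zero_add, pow_one]
    refine (h₀ f w _ l q F s hs (by omega) h0 h1 h4 (fun i hi => hw i (Nat.zero_le _) hi)
      hF).weaken fun t ⟨ht1, ht2, ht3⟩ => ⟨ht1, ht2, fun x hx hx2 => ?_, fun x hx hx' => ?_⟩
    · exact ht3 x (by omega) hx2 (Or.inl hx)
    · have := le_blockReg d 0 0
      exact ht3 x hx (by omega) (by omega)
  | succ k ih =>
    intro hk
    obtain ⟨C, hC⟩ := ih (by omega)
    refine ⟨3 * (d + 1) * ((d + 2) * 5 + C + 2) + 2, fun f w l q F s hs h0 h1 h4 hw hF => ?_⟩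
    set R := 3 * (q * l + d) with hR
    set N := max l 1 * max q 1 with hN
    have hcnt20 := le_blockReg d k (d + 2)
    have hcntk : blockReg d k (d + 2) < blockReg d (k + 1) 0 :=
      blockReg_lt_of_lt (by omega) (by omega) _
    have hkk : blockReg d k 0 < blockReg d k (d + 2) := by unfold blockReg; omega
    have hkd : blockReg d k (d + 2) < blockReg d d 0 := blockReg_lt_of_lt (by omega) (by omega) _
    have hk20 := le_blockReg d k 0
    let Inv : ℕ → State → Prop := fun r t =>
      Lists q (F ∪ ⋃ r' < r, listedFamily l q d R f k (Function.update w k r')) t ∧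
      t.bank 4 = s.bank 4 ∧ (∀ x < 5, x ≠ 2 → t.reg x = s.reg x) ∧
      (∀ x < blockReg d d 0, blockReg d (k + 1) 0 ≤ x → t.reg x = s.reg x)
    refine (Runs.count (n := R) (K := (d + 2) * 5 + C * N ^ (k + 1)) (by omega) (by omega) Inv
      ?_ ?_ ?_ hs.1 h4).mono ?_ fun t ⟨⟨ht1, ht2, ht3, ht4⟩, _⟩ => ⟨?_, ht2, ht3, ht4⟩
    · rintro r t v ⟨ht1, ht2, ht3, ht4⟩
      refine ⟨ht1.of_eq ?_ (by simp), by simpa using ht2, fun x hx hx2 => ?_, fun x hx hx' => ?_⟩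
      · rw [State.setReg_reg, if_neg (by omega)]
      · rw [State.setReg_reg, if_neg (by omega), ht3 x hx hx2]
      · rw [State.setReg_reg, if_neg (by omega), ht4 x hx hx']
    · rintro r hr t ⟨ht1, ht2, ht3, ht4⟩ hxt hyt h4t
      have hft : Filled d f R t := hs.of_eq (ht3 3 (by omega) (by omega)) ht2
      refine Runs.seq ((Runs.loadRow hft hr hxt).weaken fun u ⟨hu1, hu2, hu3⟩ => ?_)
      have hu5 : ∀ x < 5, u.reg x = t.reg x := fun x hx =>
        hu2 x (by omega) (by omega) (Or.inl (by omega))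
      refine (hC f (Function.update w k r) l q
        (F ∪ ⋃ r' < r, listedFamily l q d R f k (Function.update w k r')) u
        (hft.of_eq (hu5 3 (by omega)) (by rw [hu3]))
        (by rw [hu5 0 (by omega), ht3 0 (by omega) (by omega), h0])
        (by rw [hu5 1 (by omega), ht3 1 (by omega) (by omega), h1])
        (by rw [hu5 4 (by omega), h4t]) ?_
        (ht1.of_eq (hu5 2 (by omega)) (by rw [hu3]))).weaken
        fun v ⟨hv1, hv2, hv3, hv4⟩ => ⟨⟨?_, ?_, ?_, ?_⟩, ?_, ?_, ?_⟩
      · intro i hi hid e he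
        rcases hi.eq_or_lt with rfl | hi
        · rw [hu1 e he, Function.update_self]
        · have g1 : blockReg d k (d + 2) < blockReg d i e :=
            blockReg_lt_of_lt hi (by omega) _
          have g2 : blockReg d (k + 1) 0 ≤ blockReg d i e := by
            rcases (show k + 1 < i ∨ k + 1 = i by omega) with h | rfl
            · exact (blockReg_lt_of_lt h (by omega) _).le
            · unfold blockReg; omega
          rw [hu2 _ (by omega) (by omega) (Or.inr g1.le),
            ht4 _ (blockReg_lt_of_lt hid (by omega) _) g2, Function.update_of_ne hi.ne',
            hw i hi hid e he]
      · have : (⋃ r' < r + 1, listedFamily l q d R f k (Function.update w k r')) =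
            (⋃ r' < r, listedFamily l q d R f k (Function.update w k r')) ∪
              listedFamily l q d R f k (Function.update w k r) :=
          Set.biUnion_lt_succ _ _
        rw [this, ← Set.union_assoc]
        exact hv1
      · rw [hv2, hu3, ht2]
      · intro x hx hx2
        rw [hv3 x hx hx2, hu5 x hx, ht3 x hx hx2]
      · intro x hx hx'
        rw [hv4 x hx (by omega), hu2 x (by omega) (by omega) (Or.inr (by omega)), ht4 x hx hx']
      · rw [hv4 _ hkd hkk.le, hu2 _ (by omega) (by omega) (Or.inr le_rfl), hxt]
      · rw [hv3 3 (by omega) (by omega), hu5 3 (by omega), hyt]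
      · rw [hv3 4 (by omega) (by omega), hu5 4 (by omega), h4t]
    · refine ⟨?_, rfl, fun _ _ _ => rfl, fun _ _ _ => rfl⟩
      simpa using hF
    · have g1 : 1 ≤ N := Nat.mul_pos (by omega) (by omega)
      have g2 : q * l ≤ N := by
        rw [mul_comm]; exact Nat.mul_le_mul (le_max_left _ _) (le_max_left _ _)
      have g3 : 1 ≤ N ^ (k + 1) := Nat.one_le_pow _ _ g1
      have g4 : R ≤ 3 * (d + 1) * N := by nlinarith
      calc R * ((d + 2) * 5 + C * N ^ (k + 1) + 2) + 2
          ≤ (3 * (d + 1) * N) * ((d + 2) * 5 * N ^ (k + 1) + C * N ^ (k + 1) + 2 * N ^ (k + 1)) +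
            2 * N ^ (k + 2) := by
            have g5 : 1 ≤ N ^ (k + 2) := Nat.one_le_pow _ _ g1
            exact Nat.add_le_add (Nat.mul_le_mul g4 (Nat.add_le_add (Nat.add_le_add
              (Nat.le_mul_of_pos_right _ g3) le_rfl) (Nat.le_mul_of_pos_right _ g3)))
              (Nat.le_mul_of_pos_right _ g5)
        _ = (3 * (d + 1) * ((d + 2) * 5 + C + 2) + 2) * N ^ (k + 1 + 1) := by ring
    · rw [listedFamily_succ]
      exact ht1

end Enumerate

/-! ### Assembling the program and the bounds. -/

/-- The program computing the family of separated subsets. -/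
def Program.separate (d : ℕ) (c cdet ctest : Program) : Program :=
  .seq (.fillTable d c) (.seq (.nest d (.emit d cdet ctest) d) (.copy 0 2))

theorem exists_program_separate (d : ℕ) : ∃ (c : Program) (C : ℕ), ∀ (l q : ℕ)
    (A : Matrix (Fin l) (Fin d) ℝ) (b : Fin l → ℝ) (p : Fin q → Fin d → ℝ),
    ComputesWithin c A b p (SepFamily (openPolyhedron A b) (Set.range p))
      (C * (max l 1 * max q 1) ^ (d + 1)) := by
  obtain ⟨c, C₁, h₁⟩ := exists_runs_fillTable d
  obtain ⟨cdet, ctest, h₂⟩ := exists_runs_nest d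
  obtain ⟨C₂, h₂⟩ := h₂ d le_rfl
  refine ⟨.separate d c cdet ctest, C₁ + C₂ + 1, fun l q A b p => ?_⟩
  set N := max l 1 * max q 1 with hN
  suffices h : Runs (.separate d c cdet ctest) (sepInput A b p)
      ((C₁ + C₂ + 1) * N ^ (d + 1)) fun t =>
        Displays t p (SepFamily (openPolyhedron A b) (Set.range p)) by
    obtain ⟨t, n, ht, hn, hd⟩ := h
    exact ⟨t, n, ht, hn, hd⟩
  have g1 : 1 ≤ N := Nat.mul_pos (by omega) (by omega)
  have g2 : 1 ≤ N ^ (d + 1) := Nat.one_le_pow _ _ g1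
  have g3 : N ≤ N ^ (d + 1) := Nat.le_self_pow (by omega) _
  refine (Runs.seq (K₁ := C₁ * N) (K₂ := C₂ * N ^ (d + 1) + 1) ((h₁ l q (sepInput A b p)
    rfl rfl rfl).weaken fun t ⟨ht1, ht2, ht3, ht4, ht5⟩ => ?_)).mono (by nlinarith) fun _ h => h
  have hlist : Lists q ∅ t := by
    refine ⟨0, by rw [ht4]; simp [sepInput], by simp, by simp⟩
  refine Runs.seq ((h₂ _ 0 l q ∅ t ht1 ht2 ht3 ht5 (fun i hi hi' => by omega) hlist).weaken
    fun u ⟨⟨m, hm, hbits, hF⟩, _⟩ => Runs.copy ⟨m, by simp [hm], fun r hr j => ?_, ?_⟩)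
  · exact hbits r hr j j.2
  rw [sepFamily_openPolyhedron_eq]
  rw [Set.empty_union] at hF
  ext S
  have himage : ∀ B : Set ℕ, ∀ (E : ℕ → Prop), B = {j | j < q ∧ E j} →
      {x | ∃ j : Fin q, p j = x ∧ E j} = {x | ∃ j : Fin q, p j = x ∧ (j : ℕ) ∈ B} := by
    rintro B E rfl
    ext x
    simp
  constructor
  · rintro ⟨w, hw, hdet, rfl⟩
    have hmem : {j | j < q ∧ SelectsPoint l d (signedRow l q d (matBank A) (vecBank b) (matBank p))
        w j} ∈ listedFamily l q d (3 * (q * l + d))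
          (signedRow l q d (matBank A) (vecBank b) (matBank p)) d 0 := by
      -- Only the first `d` entries of `w` matter; the rest must equal the default `0` with which
      -- the enumeration starts.
      refine ⟨fun i => if i < d then w i else 0, fun i hi => by simpa [hi] using hw i hi,
        fun i hi => by simp [hi.not_gt], ?_, ?_⟩
      · convert hdet using 2
        funext k e
        simp [normalMatrix]
      · ext j
        refine and_congr_right fun _ => ?_
        unfold SelectsPoint
        refine forall₂_congr fun i _ => ?_
        have : ∀ k, (if k < d then (if k < d then w k else 0) else 3 * (j * l + i)) =
            if k < d then w k else 3 * (j * l + i) := fun k => by split_ifs <;> rfl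
        simp only [this]
    have hmem' := hF.subset hmem
    obtain ⟨r, hr, hB⟩ := hmem'
    exact ⟨r, hr, (himage _ _ rfl).trans
      (himage _ (fun j => u.bank 3 (r * q + j) = 1) hB).symm⟩
  · rintro ⟨r, hr, rfl⟩
    obtain ⟨w, hw, -, hdet, hB⟩ := hF.superset ⟨r, hr, rfl⟩
    refine ⟨w, hw, hdet, ?_⟩
    have e1 := himage _ _ hB
    rw [show {x | ∃ j : Fin q, p j = x ∧ (u.setReg 0 (u.reg 2)).bank 3 (r * q + j) = 1} = _ from
      himage _ (fun j => (u.setReg 0 (u.reg 2)).bank 3 (r * q + j) = 1) rfl]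
    exact e1.symm

end RealRAM

theorem theorem2 (d : ℕ) (hd : 1 ≤ d) :
    ∃ c : RealRAM.Program,
      (∃ C : ℕ, ∀ (l : ℕ) (A : Matrix (Fin l) (Fin d) ℝ) (b : Fin l → ℝ)
        (P : Finset (Fin d → ℝ)) (p : Fin P.card ≃ P),
        RealRAM.ComputesWithin c A b (fun j => (p j : Fin d → ℝ))
          (SepFamily (openPolyhedron A b) (P : Set (Fin d → ℝ)))
          (C * (max l 1 * max P.card 1) ^ (d + 1))) ∧
      (∀ (l : ℕ) (A : Matrix (Fin l) (Fin d) ℝ) (b : Fin l → ℝ),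
        ∃ C : ℕ, ∀ (P : Finset (Fin d → ℝ)) (p : Fin P.card ≃ P),
        RealRAM.ComputesWithin c A b (fun j => (p j : Fin d → ℝ))
          (SepFamily (openPolyhedron A b) (P : Set (Fin d → ℝ)))
          (C * (max P.card 1) ^ (d + 1))) ∧
      (∀ (l : ℕ) (A : Matrix (Fin l) (Fin d) ℝ) (b : Fin l → ℝ), (∀ i, A i ≠ 0) →
        ∃ C : ℕ, ∀ (P : Finset (Fin d → ℝ)) (p : Fin P.card ≃ P),
        RealRAM.ComputesWithin c A b (fun j => (p j : Fin d → ℝ))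
          (SepFamily (interior (closedPolyhedron A b)) (P : Set (Fin d → ℝ)))
          (C * (max P.card 1) ^ (d + 1))) := by
  obtain ⟨c, C, h⟩ := RealRAM.exists_program_separate d
  have hopen : ∀ (l : ℕ) (A : Matrix (Fin l) (Fin d) ℝ) (b : Fin l → ℝ)
      (P : Finset (Fin d → ℝ)) (p : Fin P.card ≃ P),
      RealRAM.ComputesWithin c A b (fun j => (p j : Fin d → ℝ))
        (SepFamily (openPolyhedron A b) (P : Set (Fin d → ℝ)))
        (C * (max l 1 * max P.card 1) ^ (d + 1)) := by
    intro l A b P p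
    have hrange : Set.range (fun j => (p j : Fin d → ℝ)) = (P : Set (Fin d → ℝ)) := by
      rw [show (fun j => (p j : Fin d → ℝ)) = Subtype.val ∘ p from rfl, Set.range_comp,
        p.surjective.range_eq, Set.image_univ]
      exact Subtype.range_coe
    rw [← hrange]
    exact h l P.card A b _
  have hfixed : ∀ (l : ℕ) (A : Matrix (Fin l) (Fin d) ℝ) (b : Fin l → ℝ),
      ∃ C : ℕ, ∀ (P : Finset (Fin d → ℝ)) (p : Fin P.card ≃ P),
      RealRAM.ComputesWithin c A b (fun j => (p j : Fin d → ℝ))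
        (SepFamily (openPolyhedron A b) (P : Set (Fin d → ℝ)))
        (C * (max P.card 1) ^ (d + 1)) := by
    intro l A b
    -- For a fixed window the power of `l` is a constant.
    refine ⟨C * (max l 1) ^ (d + 1), fun P p => ?_⟩
    rw [mul_assoc, ← mul_pow]
    exact hopen l A b P p
  refine ⟨c, ⟨C, hopen⟩, hfixed, fun l A b hA => ?_⟩
  rw [interior_closedPolyhedron A b hA]
  exact hfixed l A b
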